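/- Let $b>0$. On $L^2(\mathbb R)$ let $\widehat\psi(k)=\int_{\mathbb R}e^{-2\pi i kx}\psi(x)\,dx$ be the Fourier transform, let $U$ be the self-adjoint operator $\widehat{U\psi}(k)=e^{-2\pi bk}\widehat\psi(k)$ on its maximal domain $\{\psi\in L^2(\mathbb R): e^{-2\pi bk}\widehat\psi(k)\in L^2(\mathbb R)\}$ (formally $(U\psi)(x)=\psi(x+ib)$), and let $H_0=U+U^{-1}$ on $\operatorname{dom}(U)\cap\operatorname{dom}(U^{-1})$. Let $L:\mathbb R\to\mathbb R$ be continuous and bounded below, with $L(x)\to+\infty$ as $|x|\to\infty$. Assume that the operator sum $H_0+L$ is densely defined, i.e. that the common domain $\operatorname{dom}(H_0)\cap\{\psi\in L^2(\mathbb R): L\psi\in L^2(\mathbb R)\}$ is dense in $L^2(\mathbb R)$, and let $T$ be the Friedrichs extension of the symmetric, bounded below operator $H_0+L$ on this common domain. Then the operator $T$ is self-adjoint and has purely discrete spectrum consisting of finite multiplicity eigenvalues tending to $+\infty$. That is: every point of the spectrum of $T$ is an isolated point of the spectrum and an eigenvalue of finite multiplicity, and there is an infinite sequence of real numbers $\lambda_1\le\lambda_2\le\cdots$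 with $\lambda_n\to+\infty$ such that the spectrum of $T$ is $\{\lambda_n : n\ge1\}$ and each eigenvalue occurs in the sequence as often as its multiplicity. -/

import Mathlib

open MeasureTheory Filter Topology

noncomputable section

namespace FunctionalDifference

/-! ## Unbounded operators on a complex Hilbert space -/

section Abstract

variable {E : Type*} [NormedAddCommGroup E] [InnerProductSpace ℂ E]

/-- The quadratic form `x ↦ ⟨S x, x⟩` (its real part, which is the form itself when `S` is
symmetric) of a partially defined operator. -/
def quadForm (S : E →ₗ.[ℂ] E) (x : S.domain) : ℝ := (inner ℂ (S x) (x : E)).re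

/-- `S` is bounded below: `⟨S x, x⟩ ≥ c ‖x‖²` on the domain of `S`, for some real `c`. -/
def IsBoundedBelow (S : E →ₗ.[ℂ] E) : Prop :=
  ∃ c : ℝ, ∀ x : S.domain, c * ‖(x : E)‖ ^ 2 ≤ quadForm S x

theorem quadForm_parallelogram (S : E →ₗ.[ℂ] E) (x y : S.domain) :
    quadForm S (x + y) + quadForm S (x - y) = 2 * quadForm S x + 2 * quadForm S y := by
  simp only [quadForm, LinearPMap.map_add, LinearPMap.map_sub, Submodule.coe_add,
    Submodule.coe_sub, inner_add_left, inner_add_right, inner_sub_left, inner_sub_right,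
    Complex.add_re, Complex.sub_re]
  ring

theorem quadForm_smul (S : E →ₗ.[ℂ] E) (a : ℂ) (x : S.domain) :
    quadForm S (a • x) = ‖a‖ ^ 2 * quadForm S x := by
  simp only [quadForm, LinearPMap.map_smul, Submodule.coe_smul, inner_smul_left,
    inner_smul_right]
  rw [← mul_assoc, Complex.mul_conj, Complex.re_ofReal_mul, Complex.normSq_eq_norm_sq]

/-- The domain of the closure of the quadratic form of an operator `S` that is bounded below:
all limits `ψ` of sequences of the domain of `S` that are Cauchy for the form. (As the sequence
converges in norm and `S` is bounded below, being Cauchy for `⟨S x, x⟩` and for the form norm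
`⟨S x, x⟩ + (1 - c) ‖x‖²` is the same.) -/
def formDomain (S : E →ₗ.[ℂ] E) (hS : IsBoundedBelow S) : Submodule ℂ E where
  carrier := {ψ | ∃ φ : ℕ → S.domain, Tendsto (fun n => (φ n : E)) atTop (𝓝 ψ) ∧
    Tendsto (fun p : ℕ × ℕ => quadForm S (φ p.1 - φ p.2)) atTop (𝓝 0)}
  zero_mem' := ⟨fun _ => 0, by simp, by simp [quadForm]⟩
  add_mem' := by
    rintro ψ₁ ψ₂ ⟨φ₁, h₁, k₁⟩ ⟨φ₂, h₂, k₂⟩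
    refine ⟨fun n => φ₁ n + φ₂ n, by simpa using h₁.add h₂, ?_⟩
    obtain ⟨c, hc⟩ := hS
    have diff : ∀ (φ : ℕ → S.domain) (ψ : E), Tendsto (fun n => (φ n : E)) atTop (𝓝 ψ) →
        Tendsto (fun p : ℕ × ℕ => ((φ p.1 - φ p.2 : S.domain) : E)) atTop (𝓝 0) := by
      intro φ ψ h
      have := (h.comp (tendsto_fst (f := atTop) (g := (atTop : Filter ℕ)))).sub
        (h.comp (tendsto_snd (f := (atTop : Filter ℕ)) (g := atTop)))
      rw [prod_atTop_atTop_eq, sub_self] at this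
      exact this
    have d₁ := diff φ₁ ψ₁ h₁
    have d₂ := diff φ₂ ψ₂ h₂
    have lo : Tendsto (fun p : ℕ × ℕ => c * ‖((φ₁ p.1 - φ₁ p.2 : S.domain) : E) +
        ((φ₂ p.1 - φ₂ p.2 : S.domain) : E)‖ ^ 2) atTop (𝓝 0) := by
      simpa using (((d₁.add d₂).norm).pow 2).const_mul c
    have lo' : Tendsto (fun p : ℕ × ℕ => c * ‖((φ₁ p.1 - φ₁ p.2 : S.domain) : E) -
        ((φ₂ p.1 - φ₂ p.2 : S.domain) : E)‖ ^ 2) atTop (𝓝 0) := by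
      simpa using (((d₁.sub d₂).norm).pow 2).const_mul c
    have up := ((k₁.const_mul 2).add (k₂.const_mul 2)).sub lo'
    simp only [mul_zero, add_zero, sub_zero] at up
    refine tendsto_of_tendsto_of_tendsto_of_le_of_le lo up (fun p => ?_) (fun p => ?_)
    · have := hc ((φ₁ p.1 - φ₁ p.2) + (φ₂ p.1 - φ₂ p.2))
      rw [add_sub_add_comm]
      simpa only [Submodule.coe_add] using this
    · have h1 := hc ((φ₁ p.1 - φ₁ p.2) - (φ₂ p.1 - φ₂ p.2))
      have h2 := quadForm_parallelogram S (φ₁ p.1 - φ₁ p.2) (φ₂ p.1 - φ₂ p.2)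
      rw [Submodule.coe_sub] at h1
      simp only [add_sub_add_comm]
      linarith
  smul_mem' := by
    rintro a ψ ⟨φ, h, k⟩
    refine ⟨fun n => a • φ n, by simpa using h.const_smul a, ?_⟩
    simpa [← smul_sub, quadForm_smul] using k.const_mul (‖a‖ ^ 2)

/-- The Friedrichs extension of a densely defined symmetric operator `S` that is bounded below:
the restriction of the adjoint `S†` to those vectors of its domain that lie in the domain of the
closed quadratic form. -/
def friedrichsExtension [CompleteSpace E] (S : E →ₗ.[ℂ] E) (hS : IsBoundedBelow S) :
    E →ₗ.[ℂ] E :=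
  S.adjoint.domRestrict (formDomain S hS)

/-- `z` is in the resolvent set of `T` if `T - z` maps the domain of `T` bijectively onto `E`,
with a bounded inverse `R`. -/
def resolventSet (T : E →ₗ.[ℂ] E) : Set ℂ :=
  {z | ∃ R : E →L[ℂ] E,
    (∀ y : E, ∃ h : R y ∈ T.domain, T ⟨R y, h⟩ - z • R y = y) ∧
    ∀ x : T.domain, R (T x - z • (x : E)) = x}

/-- The spectrum of `T`. -/
def spec (T : E →ₗ.[ℂ] E) : Set ℂ := (resolventSet T)ᶜ

/-- The eigenspace `ker (T - z)`, as a subspace of `E`. -/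
def eigenspace (T : E →ₗ.[ℂ] E) (z : ℂ) : Submodule ℂ E where
  carrier := {x | ∃ h : x ∈ T.domain, T ⟨x, h⟩ = z • x}
  zero_mem' := ⟨T.domain.zero_mem, by
    have := T.map_zero
    rw [smul_zero]; exact this⟩
  add_mem' := by
    rintro x y ⟨hx, ex⟩ ⟨hy, ey⟩
    refine ⟨T.domain.add_mem hx hy, ?_⟩
    have := T.map_add ⟨x, hx⟩ ⟨y, hy⟩
    rw [ex, ey, ← smul_add] at this
    exact this
  smul_mem' := by
    rintro a x ⟨hx, ex⟩
    refine ⟨T.domain.smul_mem a hx, ?_⟩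
    have := T.map_smul a ⟨x, hx⟩
    rw [ex, smul_comm] at this
    exact this

/-- The spectrum of `T` is purely discrete: each of its points is an isolated point of the
spectrum and an eigenvalue of finite multiplicity. -/
def HasPurelyDiscreteSpectrum (T : E →ₗ.[ℂ] E) : Prop :=
  ∀ z ∈ spec T,
    (∃ ε > 0, ∀ w ∈ spec T, w ≠ z → ε ≤ dist w z) ∧
    eigenspace T z ≠ ⊥ ∧ FiniteDimensional ℂ (eigenspace T z)

end Abstract

/-! ## The operators on `L²(ℝ)` -/

/-- The Hilbert space `L²(ℝ)` of complex-valued functions. -/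
abbrev HilbertL2 : Type := Lp ℂ 2 (volume : Measure ℝ)

/-- Multiplication by a real function `m`, on its maximal domain `{f ∈ L² | m f ∈ L²}`. -/
def mulOp (m : ℝ → ℝ) : HilbertL2 →ₗ.[ℂ] HilbertL2 where
  domain :=
    { carrier := {f | MemLp (fun x => (m x : ℂ) * f x) 2 volume}
      zero_mem' := by
        refine (memLp_congr_ae ?_).mpr (MemLp.zero' (p := 2))
        filter_upwards [Lp.coeFn_zero ℂ 2 (volume : Measure ℝ)] with x hx
        rw [hx]
        simp
      add_mem' := by
        intro f g hf hg
        refine (memLp_congr_ae ?_).mpr (MemLp.add hf hg)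
        filter_upwards [Lp.coeFn_add f g] with x hx
        rw [hx, Pi.add_apply, Pi.add_apply, mul_add]
      smul_mem' := by
        intro a f hf
        refine (memLp_congr_ae ?_).mpr (MemLp.const_smul hf a)
        filter_upwards [Lp.coeFn_smul a f] with x hx
        rw [hx]
        simp [mul_left_comm] }
  toFun :=
    { toFun := fun f => MemLp.toLp (fun x => (m x : ℂ) * (f : HilbertL2) x) f.2
      map_add' := by
        intro f g
        rw [← MemLp.toLp_add]
        refine MemLp.toLp_congr _ _ ?_
        filter_upwards [Lp.coeFn_add (f : HilbertL2) (g : HilbertL2)] with x hx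
        change (m x : ℂ) * ((f : HilbertL2) + (g : HilbertL2) : HilbertL2) x =
          (m x : ℂ) * (f : HilbertL2) x + (m x : ℂ) * (g : HilbertL2) x
        rw [hx, Pi.add_apply, mul_add]
      map_smul' := by
        intro a f
        rw [RingHom.id_apply, ← MemLp.toLp_const_smul]
        refine MemLp.toLp_congr _ _ ?_
        filter_upwards [Lp.coeFn_smul a (f : HilbertL2)] with x hx
        change (m x : ℂ) * (a • (f : HilbertL2) : HilbertL2) x =
          a * ((m x : ℂ) * (f : HilbertL2) x)
        rw [hx, Pi.smul_apply, smul_eq_mul, mul_left_comm] }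

/-- The Fourier transform `ψ ↦ ∫ exp (-2πikx) ψ(x) dx`, as a unitary operator on `L²(ℝ)`. -/
def fourierL2 : HilbertL2 ≃ₗᵢ[ℂ] HilbertL2 := Lp.fourierTransformₗᵢ ℝ ℂ

/-- The Fourier multiplier `ψ ↦ 𝓕⁻¹ (m 𝓕ψ)`, on its maximal domain
`{ψ ∈ L² | m 𝓕ψ ∈ L²}`. -/
def fourierMulOp (m : ℝ → ℝ) : HilbertL2 →ₗ.[ℂ] HilbertL2 where
  domain := (mulOp m).domain.comap (fourierL2 : HilbertL2 →ₗ[ℂ] HilbertL2)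
  toFun :=
    { toFun := fun ψ => fourierL2.symm (mulOp m ⟨fourierL2 ψ, ψ.2⟩)
      map_add' := by
        intro ψ φ
        rw [← map_add, ← LinearPMap.map_add]
        congr 2
        exact Subtype.ext (map_add fourierL2 (ψ : HilbertL2) φ)
      map_smul' := by
        intro a ψ
        rw [RingHom.id_apply, ← map_smul, ← LinearPMap.map_smul]
        congr 2
        exact Subtype.ext (map_smul fourierL2 a (ψ : HilbertL2)) }

theorem mulOp_coeFn (m : ℝ → ℝ) (f : (mulOp m).domain) :
    (mulOp m f : ℝ → ℂ) =ᵐ[volume] fun x => (m x : ℂ) * (f : HilbertL2) x :=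
  MemLp.coeFn_toLp f.2

/-- Operators of multiplication by `m` and `1 / m` have graphs that are swaps of each other. -/
theorem mulOp_graph_swap (m n : ℝ → ℝ) (h : ∀ x, n x * m x = 1) {f g : HilbertL2}
    (hfg : (f, g) ∈ (mulOp m).graph) : (g, f) ∈ (mulOp n).graph := by
  rw [LinearPMap.mem_graph_iff] at hfg ⊢
  obtain ⟨y, hy, hg⟩ := hfg
  change (y : HilbertL2) = f at hy
  change mulOp m y = g at hg
  have key : (fun x => (n x : ℂ) * g x) =ᵐ[volume] f := by
    have := mulOp_coeFn m y
    rw [hg, hy] at this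
    filter_upwards [this] with x hx
    rw [hx, ← mul_assoc, ← Complex.ofReal_mul, h, Complex.ofReal_one, one_mul]
  have mem : g ∈ (mulOp n).domain := (memLp_congr_ae key).mpr (Lp.memLp f)
  refine ⟨⟨g, mem⟩, rfl, ?_⟩
  exact Lp.ext ((mulOp_coeFn n ⟨g, mem⟩).trans key)

theorem fourierMulOp_graph (m : ℝ → ℝ) (ψ φ : HilbertL2) :
    (ψ, φ) ∈ (fourierMulOp m).graph ↔ (fourierL2 ψ, fourierL2 φ) ∈ (mulOp m).graph := by
  simp only [LinearPMap.mem_graph_iff]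
  constructor
  · rintro ⟨y, hy, e⟩
    change (y : HilbertL2) = ψ at hy
    change fourierMulOp m y = φ at e
    subst hy e
    exact ⟨⟨fourierL2 y, y.2⟩, rfl, (fourierL2.apply_symm_apply _).symm⟩
  · rintro ⟨y, hy, e⟩
    change (y : HilbertL2) = fourierL2 ψ at hy
    change mulOp m y = fourierL2 φ at e
    refine ⟨⟨ψ, ?_⟩, rfl, ?_⟩
    · change fourierL2 ψ ∈ (mulOp m).domain
      rw [← hy]
      exact y.2
    · have : y = ⟨fourierL2 ψ, hy ▸ y.2⟩ := Subtype.ext hy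
      rw [this] at e
      exact (fourierL2.symm_apply_eq).mpr e

/-- The Weyl operator `U = exp (-bP)`, formally `(U ψ)(x) = ψ(x + ib)`: the self-adjoint operator
`𝓕⁻¹ exp (-2πbk) 𝓕` on its maximal domain. -/
def weylU (b : ℝ) : HilbertL2 →ₗ.[ℂ] HilbertL2 :=
  fourierMulOp fun k => Real.exp (-2 * Real.pi * b * k)

/-- The inverse Weyl operator is `U⁻¹ = exp (bP)`, that is, the operator of `-b`. -/
theorem weylU_inverse (b : ℝ) : (weylU b).inverse = weylU (-b) := by
  have swap : ∀ (c : ℝ) {ψ φ : HilbertL2}, (ψ, φ) ∈ (weylU c).graph → (φ, ψ) ∈ (weylU (-c)).graph := by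
    intro c ψ φ h
    refine (fourierMulOp_graph _ _ _).mpr
      (mulOp_graph_swap _ _ (fun x => ?_) ((fourierMulOp_graph _ _ _).mp h))
    rw [← Real.exp_add]
    simp
  have ker : LinearMap.ker (weylU b).toFun = ⊥ := by
    rw [LinearMap.ker_eq_bot']
    intro x hx
    have h := swap b ((weylU b).mem_graph x)
    have hx' : weylU b x = 0 := hx
    rw [hx'] at h
    exact Subtype.ext (LinearPMap.graph_fst_eq_zero_snd _ h rfl)
  refine LinearPMap.eq_of_eq_graph (Submodule.ext fun p => ?_)
  obtain ⟨φ, ψ⟩ := p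
  rw [LinearPMap.inverse_graph ker, Submodule.mem_map]
  constructor
  · rintro ⟨⟨u, v⟩, h, e⟩
    obtain ⟨rfl, rfl⟩ := Prod.mk.inj e
    exact swap b h
  · intro h
    have := swap (-b) h
    rw [neg_neg] at this
    exact ⟨(ψ, φ), this, rfl⟩

/-- The free operator `H₀ = U + U⁻¹`, on the intersection of the domains of `U` and `U⁻¹`. -/
def freeOp (b : ℝ) : HilbertL2 →ₗ.[ℂ] HilbertL2 := weylU b + weylU (-b)

/-- The operator sum `H₀ + L`, on the common domain of `H₀` and of multiplication by `L`. -/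
def minimalOp (b : ℝ) (L : ℝ → ℝ) : HilbertL2 →ₗ.[ℂ] HilbertL2 := freeOp b + mulOp L

theorem quadForm_add (S T : HilbertL2 →ₗ.[ℂ] HilbertL2) (x : (S + T).domain) :
    quadForm (S + T) x = quadForm S ⟨x, x.2.1⟩ + quadForm T ⟨x, x.2.2⟩ := by
  simp only [quadForm, LinearPMap.add_apply, inner_add_left, Complex.add_re]

theorem le_quadForm_mulOp (m : ℝ → ℝ) (c : ℝ) (hc : ∀ x, c ≤ m x) (f : (mulOp m).domain) :
    c * ‖(f : HilbertL2)‖ ^ 2 ≤ quadForm (mulOp m) f := by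
  have e1 : ‖(f : HilbertL2)‖ ^ 2 = (inner ℂ (f : HilbertL2) (f : HilbertL2)).re :=
    (inner_self_eq_norm_sq (𝕜 := ℂ) (f : HilbertL2)).symm
  have e2 : c * ‖(f : HilbertL2)‖ ^ 2 = (inner ℂ ((c : ℂ) • (f : HilbertL2)) (f : HilbertL2)).re := by
    rw [e1, inner_smul_left, Complex.conj_ofReal, Complex.re_ofReal_mul]
  rw [e2, quadForm, L2.inner_def, L2.inner_def]
  have i1 := L2.integrable_inner (𝕜 := ℂ) ((c : ℂ) • (f : HilbertL2)) (f : HilbertL2)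
  have i2 := L2.integrable_inner (𝕜 := ℂ) (mulOp m f) (f : HilbertL2)
  have r1 := integral_re i1
  have r2 := integral_re i2
  simp only [RCLike.re_to_complex] at r1 r2
  rw [← r1, ← r2]
  refine integral_mono_ae i1.re i2.re ?_
  filter_upwards [Lp.coeFn_smul (c : ℂ) (f : HilbertL2), mulOp_coeFn m f] with x h1 h2
  change (inner ℂ _ _ : ℂ).re ≤ (inner ℂ _ _ : ℂ).re
  rw [h1, h2, Pi.smul_apply, smul_eq_mul, ← smul_eq_mul, ← smul_eq_mul, inner_smul_left,
    inner_smul_left, Complex.conj_ofReal, Complex.conj_ofReal, Complex.re_ofReal_mul,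
    Complex.re_ofReal_mul]
  have h0 : 0 ≤ (inner ℂ ((f : HilbertL2) x) ((f : HilbertL2) x)).re :=
    inner_self_nonneg (𝕜 := ℂ) (x := (f : HilbertL2) x)
  exact mul_le_mul_of_nonneg_right (hc x) h0

theorem quadForm_fourierMulOp (m : ℝ → ℝ) (ψ : (fourierMulOp m).domain) :
    quadForm (fourierMulOp m) ψ = quadForm (mulOp m) ⟨fourierL2 ψ, ψ.2⟩ := by
  have h := fourierL2.inner_map_map (fourierMulOp m ψ) (ψ : HilbertL2)
  unfold quadForm
  rw [← h]
  congr 2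
  exact fourierL2.apply_symm_apply _

theorem quadForm_weylU_nonneg (b : ℝ) (ψ : (weylU b).domain) : 0 ≤ quadForm (weylU b) ψ := by
  have := le_quadForm_mulOp _ 0 (fun k => (Real.exp_pos (-2 * Real.pi * b * k)).le)
    ⟨fourierL2 ψ, ψ.2⟩
  rw [zero_mul] at this
  exact this.trans_eq (quadForm_fourierMulOp _ ψ).symm

/-- `H₀ + L` is bounded below if `L` is. -/
theorem minimalOp_isBoundedBelow (b : ℝ) {L : ℝ → ℝ} (hL : BddBelow (Set.range L)) :
    IsBoundedBelow (minimalOp b L) := by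
  obtain ⟨c, hc⟩ := hL
  refine ⟨c, fun x => ?_⟩
  have h1 := le_quadForm_mulOp L c (fun y => hc ⟨y, rfl⟩) ⟨x, x.2.2⟩
  have h2 := quadForm_weylU_nonneg b ⟨x, x.2.1.1⟩
  have h3 := quadForm_weylU_nonneg (-b) ⟨x, x.2.1.2⟩
  have e1 : quadForm (minimalOp b L) x = _ := quadForm_add (freeOp b) (mulOp L) x
  have e2 : quadForm (freeOp b) ⟨x, x.2.1⟩ = _ :=
    quadForm_add (weylU b) (weylU (-b)) ⟨x, x.2.1⟩
  rw [e1, e2]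
  linarith

/-- The operator `T = H₀ + L`, understood as the Friedrichs extension of the operator sum on the
common domain of `H₀` and `L`. -/
def opT (b : ℝ) (L : ℝ → ℝ) (hL : BddBelow (Set.range L)) : HilbertL2 →ₗ.[ℂ] HilbertL2 :=
  friedrichsExtension (minimalOp b L) (minimalOp_isBoundedBelow b hL)

end FunctionalDifference

end

/-! # The spectrum of a functional difference operator with a confining potential

Let `S = H₀ + L` on its natural domain and let `c` be a lower bound of `L`. Completing the domain of
`S` for the form `⟨S x, y⟩ + (1 - c) ⟨x, y⟩` gives a Hilbert space `H` with a contraction `J` into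
`L²(ℝ)`, and `R = J J†` is the resolvent of the Friedrichs extension `T` at the point `c - 1`
(`exists_compact_resolvent_friedrichsExtension`). So `T` is, up to a shift, the inverse of the
injective positive operator `R`, and hence self-adjoint (`IsResolventAt.isSelfAdjoint`).

The operator `R` is compact because `J` is. Indeed the form dominates both
`∫ (exp (-2πbk) + exp (2πbk)) |𝓕ψ(k)|² dk` and `∫ (L - c) |ψ|²`, whose weights tend to infinity, so
that on vectors of bounded form norm the truncation `𝓕⁻¹ 1_{|k| ≤ K} 𝓕 1_{|x| ≤ N}` is uniformly
close to the identity for large `K` and `N` (`minimalOp_exists_compact_approx`). The truncation is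
compact, since its kernel `exp (-2πikx)` is on a bounded region the uniform limit of its Taylor
polynomials, which are kernels of finite rank (`isCompactOperator_cutoff_fourier_cutoff`). Thus `J`
is a limit in norm of compact operators.

The rest is the spectral theory of the compact positive operator `R`, transported by
`z ↦ (z - (c - 1))⁻¹` (`IsResolventAt.discrete_spectrum`). The Fredholm alternative identifies the
spectrum of `T` with its eigenvalues, an orthonormal system of eigenvectors shows that these have no
finite accumulation point, and density of the span of the eigenvectors shows that there are
infinitely many of them. -/

namespace FunctionalDifference

/-! ### The resolvent of the Friedrichs extension -/

/-- `R` is the resolvent of `T` at `z`: a bounded two-sided inverse of `T - z`. -/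
def IsResolventAt {E : Type*} [NormedAddCommGroup E] [InnerProductSpace ℂ E]
    (T : E →ₗ.[ℂ] E) (z : ℂ) (R : E →L[ℂ] E) : Prop :=
  (∀ y : E, ∃ h : R y ∈ T.domain, T ⟨R y, h⟩ - z • R y = y) ∧
    ∀ x : T.domain, R (T x - z • (x : E)) = x

universe u

/-- A vector space with a positive definite inner product has a completion. The space carries no
norm of its own here, so that the lemma applies to the domain of an operator, equipped with the form
of that operator in place of the ambient inner product. -/
theorem exists_completion_of_core {V : Type u} [AddCommGroup V] [Module ℂ V]
    (core : InnerProductSpace.Core ℂ V) :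
    ∃ (H : Type u) (_ : NormedAddCommGroup H) (_ : InnerProductSpace ℂ H) (_ : CompleteSpace H)
      (ι : V →ₗ[ℂ] H), DenseRange ι ∧ ∀ x y, inner ℂ (ι x) (ι y) = core.inner x y := by
  let := core.toNormedAddCommGroup
  let : InnerProductSpace ℂ V := InnerProductSpace.ofCore core.toCore
  exact ⟨UniformSpace.Completion V, inferInstance, inferInstance, inferInstance,
    (UniformSpace.Completion.toComplₗᵢ (𝕜 := ℂ) (E := V)).toLinearMap,
    UniformSpace.Completion.denseRange_coe, fun x y => UniformSpace.Completion.inner_coe x y⟩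

section Friedrichs

variable {E : Type u} [NormedAddCommGroup E] [InnerProductSpace ℂ E]

theorem inner_self_eq_quadForm {S : E →ₗ.[ℂ] E} (hsym : S.IsFormalAdjoint S) (x : S.domain) :
    inner ℂ (S x) (x : E) = (quadForm S x : ℂ) := by
  have h : (starRingEnd ℂ) (inner ℂ (S x) (x : E)) = inner ℂ (S x) (x : E) := by
    rw [inner_conj_symm]; exact (hsym x x).symm
  exact (Complex.conj_eq_iff_re.mp h).symm

/-- The form `⟨S x, y⟩ + (1 - c) ⟨x, y⟩` of a symmetric operator `S ≥ c`, as an inner product on the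
domain of `S`; its square norm dominates `‖x‖²`. -/
noncomputable abbrev formCore (S : E →ₗ.[ℂ] E) (hsym : S.IsFormalAdjoint S) (c : ℝ)
    (hc : ∀ x : S.domain, c * ‖(x : E)‖ ^ 2 ≤ quadForm S x) :
    InnerProductSpace.Core ℂ S.domain where
  inner x y := inner ℂ (S x) (y : E) + (1 - c : ℂ) * inner ℂ (x : E) (y : E)
  conj_inner_symm x y := by
    simp only [map_add, map_mul, inner_conj_symm, map_sub, map_one, Complex.conj_ofReal]
    rw [hsym x y]
  re_inner_nonneg x := by
    rw [inner_self_eq_quadForm hsym, inner_self_eq_norm_sq_to_K]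
    have := hc x
    have h2 := sq_nonneg ‖(x : E)‖
    simp only [RCLike.re_to_complex, Complex.coe_algebraMap]
    rw [← Complex.ofReal_one, ← Complex.ofReal_sub, ← Complex.ofReal_pow, ← Complex.ofReal_mul,
      ← Complex.ofReal_add, Complex.ofReal_re]
    nlinarith
  add_left x y z := by
    simp only [LinearPMap.map_add, Submodule.coe_add, inner_add_left]
    ring
  smul_left x y r := by
    simp only [LinearPMap.map_smul, Submodule.coe_smul, inner_smul_left]
    ring
  definite x h := by
    rw [inner_self_eq_quadForm hsym, inner_self_eq_norm_sq_to_K] at h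
    simp only [Complex.coe_algebraMap] at h
    rw [← Complex.ofReal_one, ← Complex.ofReal_sub, ← Complex.ofReal_pow, ← Complex.ofReal_mul,
      ← Complex.ofReal_add] at h
    have h := Complex.ofReal_eq_zero.mp h
    have := hc x
    have h2 : ‖(x : E)‖ ^ 2 = 0 := by nlinarith [sq_nonneg ‖(x : E)‖]
    exact Subtype.ext (norm_eq_zero.mp (pow_eq_zero_iff two_ne_zero |>.mp h2))

variable [CompleteSpace E]

theorem mem_friedrichsExtension_domain {S : E →ₗ.[ℂ] E} {hS : IsBoundedBelow S} {x : E} :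
    x ∈ (friedrichsExtension S hS).domain ↔ x ∈ formDomain S hS ∧ x ∈ S.adjoint.domain := by
  rfl

theorem friedrichsExtension_apply {S : E →ₗ.[ℂ] E} {hS : IsBoundedBelow S}
    (x : (friedrichsExtension S hS).domain) :
    friedrichsExtension S hS x = S.adjoint ⟨x, x.2.2⟩ := rfl

/-- The form completion `H` of `S ≥ c` maps to the ambient space by a contraction `J`, and
`J J†` is the resolvent of the Friedrichs extension at `c - 1`. Injectivity of `J` (closability of
the form) is not needed: a vector of the form domain annihilated by `S† - (c - 1)` lifts to a
vector of `H` that is orthogonal to a dense subspace. -/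
theorem exists_compact_resolvent_friedrichsExtension {S : E →ₗ.[ℂ] E} (hS : IsBoundedBelow S)
    (hdense : Dense (S.domain : Set E)) (hsym : S.IsFormalAdjoint S) {c : ℝ}
    (hc : ∀ x : S.domain, c * ‖(x : E)‖ ^ 2 ≤ quadForm S x)
    (hcpt : ∀ ε > 0, ∃ A : E →L[ℂ] E, IsCompactOperator A ∧ ∀ x : S.domain,
      ‖(x : E) - A x‖ ≤ ε * √(quadForm S x + (1 - c) * ‖(x : E)‖ ^ 2)) :
    ∃ R : E →L[ℂ] E, IsResolventAt (friedrichsExtension S hS) ((c - 1 : ℝ) : ℂ) R ∧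
      IsCompactOperator R ∧ R.IsPositive := by
  obtain ⟨H, _, _, _, ι, hι, hin⟩ := exists_completion_of_core (formCore S hsym c hc)
  have hin' : ∀ x y, inner ℂ (ι x) (ι y) =
      inner ℂ (S x) (y : E) + (1 - c : ℂ) * inner ℂ (x : E) (y : E) := hin
  have hnsq : ∀ x, ‖ι x‖ ^ 2 = quadForm S x + (1 - c) * ‖(x : E)‖ ^ 2 := by
    intro x
    have h := hin' x x
    rw [inner_self_eq_quadForm hsym, inner_self_eq_norm_sq_to_K, inner_self_eq_norm_sq_to_K] at h
    simp only [Complex.coe_algebraMap] at h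
    exact_mod_cast h
  have hn : ∀ x, ‖ι x‖ = √(quadForm S x + (1 - c) * ‖(x : E)‖ ^ 2) := fun x => by
    rw [← hnsq, Real.sqrt_sq (norm_nonneg _)]
  have hle : ∀ x : S.domain, ‖(x : E)‖ ≤ ‖ι x‖ := fun x => by
    rw [← sq_le_sq₀ (norm_nonneg _) (norm_nonneg _), hnsq]
    linarith [hc x]
  let J : H →L[ℂ] E := S.domain.subtype.extendOfNorm ι
  have hJ : ∀ x : S.domain, J (ι x) = x := fun x =>
    LinearMap.extendOfNorm_eq hι ⟨1, fun x => by simpa using hle x⟩ x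
  have hJc : IsCompactOperator J := by
    change J ∈ {f : H →L[ℂ] E | IsCompactOperator f}
    refine isClosed_setOfPred_isCompactOperator.closure_subset_iff.mpr subset_rfl ?_
    rw [Metric.mem_closure_iff]
    intro ε hε
    obtain ⟨A, hA, hAx⟩ := hcpt (ε / 2) (by positivity)
    refine ⟨A ∘L J, hA.comp_clm J, ?_⟩
    rw [dist_eq_norm]
    refine lt_of_le_of_lt (ContinuousLinearMap.opNorm_le_bound _ (by positivity) fun w => ?_)
      (half_lt_self hε)
    refine hι.induction_on (p := fun w => ‖(J - A ∘L J) w‖ ≤ ε / 2 * ‖w‖) w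
      (isClosed_le (by fun_prop) (by fun_prop)) fun x => ?_
    simpa [hJ, hn] using hAx x
  -- The form representation of `S`, extended from the domain of `S` to all of `H`.
  have key : ∀ (x : S.domain) (w : H),
      inner ℂ (S x) (J w) + (1 - c : ℂ) * inner ℂ (x : E) (J w) = inner ℂ (ι x) w := by
    intro x w
    refine hι.induction_on (p := fun w => inner ℂ (S x) (J w) + (1 - c : ℂ) * inner ℂ (x : E) (J w)
      = inner ℂ (ι x) w) w (isClosed_eq (by fun_prop) (by fun_prop)) fun y => ?_
    rw [hJ, hin']
  have hq : ∀ x : S.domain, quadForm S x = ‖ι x‖ ^ 2 - (1 - c) * ‖(x : E)‖ ^ 2 := fun x => by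
    rw [hnsq]; ring
  have hform : ∀ w : H, J w ∈ formDomain S hS := by
    intro w
    obtain ⟨u, hu, hw⟩ := mem_closure_iff_seq_limit.mp (hι w)
    choose φ hφ using hu
    obtain rfl : (fun n => ι (φ n)) = u := funext hφ
    refine ⟨φ, by simpa [hJ, Function.comp_def] using (J.continuous.tendsto w).comp hw, ?_⟩
    have h1 : Tendsto (fun p : ℕ × ℕ => ι (φ p.1) - ι (φ p.2)) atTop (𝓝 0) := by
      have := (hw.comp (tendsto_fst (f := atTop) (g := (atTop : Filter ℕ)))).sub
        (hw.comp (tendsto_snd (f := (atTop : Filter ℕ)) (g := atTop)))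
      rwa [prod_atTop_atTop_eq, sub_self] at this
    have h2 : Tendsto (fun p : ℕ × ℕ => J (ι (φ p.1) - ι (φ p.2))) atTop (𝓝 0) := by
      simpa [Function.comp_def] using (J.continuous.tendsto 0).comp h1
    have h3 := (h1.norm.pow 2).sub ((h2.norm.pow 2).const_mul (1 - c))
    simp only [norm_zero, ne_eq, OfNat.ofNat_ne_zero, not_false_eq_true, zero_pow, mul_zero,
      sub_zero] at h3
    refine h3.congr fun p => ?_
    rw [hq, ← map_sub, hJ]
  let R : E →L[ℂ] E := J ∘L ContinuousLinearMap.adjoint J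
  have hmove : ∀ (x : S.domain) (y : E),
      inner ℂ (y - (1 - c : ℂ) • R y) (x : E) = inner ℂ (R y) (S x) := by
    intro x y
    have h := key x (ContinuousLinearMap.adjoint J y)
    rw [ContinuousLinearMap.adjoint_inner_right, hJ] at h
    change inner ℂ (S x) (R y) + (1 - c : ℂ) * inner ℂ (x : E) (R y) = inner ℂ (x : E) y at h
    rw [← inner_conj_symm, ← inner_conj_symm (R y)]
    congr 1
    rw [inner_sub_right, inner_smul_right, ← h]
    ring
  have hRadj : ∀ y, R y ∈ S.adjoint.domain := fun y =>
    S.mem_adjoint_domain_of_exists _ ⟨_, fun x => hmove x y⟩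
  have hRdom : ∀ y, R y ∈ (friedrichsExtension S hS).domain := fun y =>
    mem_friedrichsExtension_domain.mpr ⟨hform _, hRadj y⟩
  have hright : ∀ y, friedrichsExtension S hS ⟨R y, hRdom y⟩ - ((c - 1 : ℝ) : ℂ) • R y = y := by
    intro y
    have h : S.adjoint ⟨R y, hRadj y⟩ = y - (1 - c : ℂ) • R y :=
      LinearPMap.adjoint_apply_eq hdense _ fun x => hmove x y
    rw [friedrichsExtension_apply]
    refine (congrArg (· - _) h).trans ?_
    push_cast
    module
  have hker : ∀ v : (friedrichsExtension S hS).domain,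
      friedrichsExtension S hS v = ((c - 1 : ℝ) : ℂ) • (v : E) → (v : E) = 0 := by
    rintro ⟨v, hv⟩ h
    obtain ⟨⟨φ, hφ, hφq⟩, hvadj⟩ := mem_friedrichsExtension_domain.mp hv
    have hφ2 : Tendsto (fun p : ℕ × ℕ => ((φ p.1 : E) - φ p.2)) atTop (𝓝 0) := by
      have := (hφ.comp (tendsto_fst (f := atTop) (g := (atTop : Filter ℕ)))).sub
        (hφ.comp (tendsto_snd (f := (atTop : Filter ℕ)) (g := atTop)))
      rwa [prod_atTop_atTop_eq, sub_self] at this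
    have hcauchy : CauchySeq fun n => ι (φ n) := by
      have h3 := hφq.add ((hφ2.norm.pow 2).const_mul (1 - c))
      have h4 : Tendsto (fun p : ℕ × ℕ => ‖ι (φ p.1) - ι (φ p.2)‖ ^ 2) atTop (𝓝 0) := by
        have e : (0 : ℝ) + (1 - c) * ‖(0 : E)‖ ^ 2 = 0 := by simp
        rw [e] at h3
        refine h3.congr fun p => ?_
        rw [← map_sub, hnsq, Submodule.coe_sub]
      rw [cauchySeq_iff_tendsto_dist_atTop_0]
      have h5 := h4.sqrt
      rw [Real.sqrt_zero] at h5
      refine h5.congr fun p => ?_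
      rw [Real.sqrt_sq (norm_nonneg _), dist_eq_norm]
    obtain ⟨w, hw⟩ := cauchySeq_tendsto_of_complete hcauchy
    have hJw : J w = v := by
      refine tendsto_nhds_unique ((J.continuous.tendsto w).comp hw) ?_
      simpa [Function.comp_def, hJ] using hφ
    have hw0 : w = 0 := by
      refine hι.eq_zero_of_inner_right ℂ fun x => ?_
      have hx := LinearPMap.adjoint_isFormalAdjoint hdense ⟨v, hvadj⟩ x
      change inner ℂ (friedrichsExtension S hS ⟨v, hv⟩) (x : E) = inner ℂ v (S x) at hx
      rw [h] at hx
      rw [← key, hJw, ← inner_conj_symm (S x), ← hx, inner_smul_left, map_mul, inner_conj_symm]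
      simp only [Complex.conj_ofReal]
      push_cast
      ring
    change v = 0
    rw [← hJw, hw0, map_zero]
  refine ⟨R, ⟨fun y => ⟨hRdom y, hright y⟩, fun x => ?_⟩, hJc.comp_clm _, ?_⟩
  · set y := friedrichsExtension S hS x - ((c - 1 : ℝ) : ℂ) • (x : E) with hy
    have h := hker (⟨R y, hRdom y⟩ - x) ?_
    · exact sub_eq_zero.mp h
    · rw [LinearPMap.map_sub, Submodule.coe_sub]
      have := hright y
      rw [sub_eq_iff_eq_add] at this
      rw [this, hy]
      module
  · exact ContinuousLinearMap.isPositive_self_comp_adjoint J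

end Friedrichs

/-! ### Operators with a compact positive resolvent -/

section CompactResolvent

variable {E : Type*} [NormedAddCommGroup E] [InnerProductSpace ℂ E]
  {T : E →ₗ.[ℂ] E} {a : ℝ} {R : E →L[ℂ] E}

theorem mem_eigenspace {z : ℂ} {x : E} :
    x ∈ eigenspace T z ↔ ∃ h : x ∈ T.domain, T ⟨x, h⟩ = z • x := Iff.rfl

theorem IsResolventAt.injective {z : ℂ} (hR : IsResolventAt T z R) {y : E} (hy : R y = 0) :
    y = 0 := by
  obtain ⟨h, e⟩ := hR.1 y
  have h0 : (⟨R y, h⟩ : T.domain) = 0 := Subtype.ext hy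
  rw [h0, hy, LinearPMap.map_zero, smul_zero, sub_zero] at e
  exact e.symm

/-- An operator with a symmetric everywhere defined resolvent at a real point is self-adjoint: the
inverse of an injective self-adjoint operator is self-adjoint. -/
theorem IsResolventAt.isSelfAdjoint [CompleteSpace E] (hR : IsResolventAt T (a : ℂ) R)
    (hsym : R.IsSymmetric) : IsSelfAdjoint T := by
  have hdense : Dense (T.domain : Set E) := by
    rw [Submodule.dense_iff_topologicalClosure_eq_top, Submodule.topologicalClosure_eq_top_iff,
      Submodule.eq_bot_iff]
    intro y hy
    refine hR.injective (ext_inner_right ℂ fun v => ?_)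
    rw [inner_zero_left]
    exact (hsym y v).trans (Submodule.inner_left_of_mem_orthogonal (hR.1 v).1 hy)
  have hformal : T.IsFormalAdjoint T := by
    intro x y
    have h := hsym (T x - (a : ℂ) • (x : E)) (T y - (a : ℂ) • (y : E))
    simp only [ContinuousLinearMap.coe_coe, hR.2, inner_sub_left, inner_sub_right, inner_smul_left,
      inner_smul_right, Complex.conj_ofReal] at h
    linear_combination -h
  rw [LinearPMap.isSelfAdjoint_def]
  refine (LinearPMap.eq_of_le_of_domain_eq (hformal.le_adjoint hdense)
    (le_antisymm (hformal.le_adjoint hdense).1 fun v hv => ?_)).symm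
  obtain ⟨hd, e⟩ := hR.1 (T.adjoint ⟨v, hv⟩ - (a : ℂ) • v)
  set w := R (T.adjoint ⟨v, hv⟩ - (a : ℂ) • v) with hw
  suffices v = w by rw [this]; exact hd
  refine ext_inner_right ℂ fun y => ?_
  obtain ⟨hy, ey⟩ := hR.1 y
  have h1 := LinearPMap.adjoint_isFormalAdjoint hdense ⟨v, hv⟩ ⟨R y, hy⟩
  have h2 := hsym (T.adjoint ⟨v, hv⟩ - (a : ℂ) • v) y
  simp only [ContinuousLinearMap.coe_coe, ← hw, inner_sub_left, inner_smul_left,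
    Complex.conj_ofReal] at h2
  rw [h2, h1]
  nth_rewrite 1 [← ey]
  rw [inner_sub_right, inner_smul_right]

theorem IsResolventAt.eigenspace_eq {z z₀ : ℂ} (hR : IsResolventAt T z₀ R) (hz : z ≠ z₀) :
    eigenspace T z = Module.End.eigenspace (R : Module.End ℂ E) (z - z₀)⁻¹ := by
  have hne : z - z₀ ≠ 0 := sub_ne_zero.mpr hz
  ext x
  rw [mem_eigenspace, Module.End.mem_eigenspace_iff, ContinuousLinearMap.coe_coe]
  constructor
  · rintro ⟨h, e⟩
    have := hR.2 ⟨x, h⟩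
    rw [e, ← sub_smul, map_smul] at this
    exact (eq_inv_smul_iff₀ hne).mpr this
  · intro h
    have hx : x = (z - z₀) • R x := by rw [h, smul_inv_smul₀ hne]
    obtain ⟨hd, e⟩ := hR.1 x
    have hxd : x ∈ T.domain := by
      rw [hx]; exact T.domain.smul_mem _ hd
    refine ⟨hxd, ?_⟩
    have hx' : (⟨x, hxd⟩ : T.domain) = (z - z₀) • ⟨R x, hd⟩ := Subtype.ext hx
    rw [hx', LinearPMap.map_smul, sub_eq_iff_eq_add.mp e]
    rw [smul_add, smul_comm, ← hx]
    module

theorem IsResolventAt.eigenspace_self {z : ℂ} (hR : IsResolventAt T z R) :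
    eigenspace T z = ⊥ := by
  refine (Submodule.eq_bot_iff _).mpr fun x hx => ?_
  obtain ⟨h, e⟩ := mem_eigenspace.mp hx
  have := hR.2 ⟨x, h⟩
  rw [e, sub_self, map_zero] at this
  exact this.symm

/-- For an operator with compact resolvent the Fredholm alternative says that the spectrum is the
set of eigenvalues. -/
theorem IsResolventAt.mem_spec_iff [CompleteSpace E] {z z₀ : ℂ} (hR : IsResolventAt T z₀ R)
    (hcpt : IsCompactOperator R) : z ∈ spec T ↔ eigenspace T z ≠ ⊥ := by
  constructor
  · contrapose!
    intro h
    refine not_not_intro (?_ : z ∈ resolventSet T)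
    rcases eq_or_ne z z₀ with rfl | hz
    · exact ⟨R, hR⟩
    have hne : z - z₀ ≠ 0 := sub_ne_zero.mpr hz
    rw [hR.eigenspace_eq hz] at h
    have hres := (hcpt.hasEigenvalue_or_mem_resolventSet (inv_ne_zero hne)).resolve_left
      fun h' => h' h
    rw [spectrum.mem_resolventSet_iff] at hres
    obtain ⟨u, hu⟩ := hres
    -- `T - z = (1 - (z - z₀) R) (T - z₀)`, so `(T - z)⁻¹ = R (1 - (z - z₀) R)⁻¹`.
    have hu' : ∀ x, (z - z₀) • (u : E →L[ℂ] E) x = x - (z - z₀) • R x := by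
      intro x
      rw [hu]
      simp [Algebra.algebraMap_eq_smul_one, smul_sub, smul_smul, hne]
    have huinv : ∀ x, (u : E →L[ℂ] E) ((↑u⁻¹ : E →L[ℂ] E) x) = x := fun x => by
      rw [← mul_apply_eq_comp, u.mul_inv, one_apply_eq_self]
    have hinvu : ∀ x, (↑u⁻¹ : E →L[ℂ] E) ((u : E →L[ℂ] E) x) = x := fun x => by
      rw [← mul_apply_eq_comp, u.inv_mul, one_apply_eq_self]
    refine ⟨(z - z₀)⁻¹ • R ∘L (↑u⁻¹ : E →L[ℂ] E), fun y => ?_, fun x => ?_⟩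
    · set v := (↑u⁻¹ : E →L[ℂ] E) y with hv
      obtain ⟨hd, e⟩ := hR.1 v
      refine ⟨T.domain.smul_mem _ hd, ?_⟩
      have h1 := hu' v
      rw [hv, huinv, ← hv] at h1
      change T ((z - z₀)⁻¹ • ⟨R v, hd⟩) - z • (z - z₀)⁻¹ • R v = y
      rw [LinearPMap.map_smul, sub_eq_iff_eq_add.mp e]
      have h2 : v = (z - z₀) • y + (z - z₀) • R v := by rw [h1]; abel
      refine smul_right_injective E hne ?_
      simp only [smul_sub, smul_comm z, smul_inv_smul₀ hne, smul_add]
      nth_rewrite 1 [h2]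
      module
    · change (z - z₀)⁻¹ • R ((↑u⁻¹ : E →L[ℂ] E) (T x - z • (x : E))) = x
      have h1 : T x - z • (x : E) = (z - z₀) • (u : E →L[ℂ] E) (T x - z₀ • (x : E)) := by
        rw [hu', hR.2]
        module
      rw [h1, map_smul, hinvu, map_smul, hR.2, inv_smul_smul₀ hne]
  · rintro h ⟨R', hR'⟩
    obtain ⟨x, hx, hx0⟩ := (Submodule.ne_bot_iff _).mp h
    have : IsResolventAt T z R' := hR'
    rw [this.eigenspace_self] at h
    exact h rfl

end CompactResolvent

/-- A compact symmetric operator has only finitely many eigenvalues outside any disc around the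
origin: normalized eigenvectors of distinct ones are orthonormal, so their images keep a fixed
distance. -/
theorem finite_eigenvalues_of_isCompactOperator {E : Type*} [NormedAddCommGroup E]
    [InnerProductSpace ℂ E] {R : E →L[ℂ] E} (hcpt : IsCompactOperator R) (hsym : R.IsSymmetric)
    {δ : ℝ} (hδ : 0 < δ) :
    {μ : ℂ | Module.End.HasEigenvalue (R : Module.End ℂ E) μ ∧ δ ≤ ‖μ‖}.Finite := by
  by_contra hinf
  let f := Set.Infinite.natEmbedding _ hinf
  have hv : ∀ n, ∃ v : E, R v = (f n : ℂ) • v ∧ ‖v‖ = 1 := by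
    intro n
    obtain ⟨v, hv⟩ := (f n).2.1.exists_hasEigenvector
    have hv0 : ‖v‖ ≠ 0 := norm_ne_zero_iff.mpr hv.2
    refine ⟨((‖v‖⁻¹ : ℝ) : ℂ) • v, ?_, ?_⟩
    · rw [map_smul, smul_comm]
      exact congrArg _ hv.apply_eq_smul
    · rw [norm_smul, Complex.norm_real, norm_inv, norm_norm, inv_mul_cancel₀ hv0]
  choose v hv hv1 using hv
  have horth : ∀ m n, m ≠ n → inner ℂ (v m) (v n) = 0 := by
    intro m n hmn
    have hne : (f m : ℂ) ≠ f n := fun h => hmn (f.injective (Subtype.ext h))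
    exact hsym.orthogonalFamily_eigenspaces hne
      ⟨v m, Module.End.mem_eigenspace_iff.mpr (hv m)⟩ ⟨v n, Module.End.mem_eigenspace_iff.mpr (hv n)⟩
  have hdist : ∀ m n, m ≠ n → δ ≤ dist (R (v m)) (R (v n)) := by
    intro m n hmn
    rw [dist_eq_norm, hv, hv]
    have h0 : inner ℂ ((f m : ℂ) • v m) ((f n : ℂ) • v n) = 0 := by
      rw [inner_smul_left, inner_smul_right, horth m n hmn, mul_zero, mul_zero]
    have h1 := norm_sub_sq (𝕜 := ℂ) ((f m : ℂ) • v m) ((f n : ℂ) • v n)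
    rw [h0, map_zero, mul_zero, sub_zero, norm_smul, norm_smul, hv1, hv1, mul_one, mul_one] at h1
    nlinarith [(f m).2.2, norm_nonneg ((f n : ℂ)), norm_nonneg ((f m : ℂ) • v m - (f n : ℂ) • v n)]
  obtain ⟨K, hK, hKs⟩ := hcpt.image_closedBall_subset_compact (f := (R : E →ₗ[ℂ] E)) 1
  obtain ⟨y, -, φ, hφ, hy⟩ := hK.tendsto_subseq (x := fun n => R (v n))
    fun n => hKs ⟨v n, by simp [hv1], rfl⟩
  obtain ⟨N, hN⟩ := Metric.cauchySeq_iff'.mp hy.cauchySeq δ hδ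
  exact (hN (N + 1) (Nat.le_succ N)).not_ge
    (hdist _ _ (hφ.injective.ne (Nat.succ_ne_self N)))

/-! ### Enumeration of the eigenvalues -/

/-- A multiplicity function on the line, with infinite support that is finite below every bound, is
the counting function of a monotone sequence: the `n`-th term is the least point `r` of the support
with more than `n` elements at or below it, counted with multiplicity. -/
theorem exists_monotone_card_eq (m : ℝ → ℕ) (hfin : ∀ B, {r | m r ≠ 0 ∧ r ≤ B}.Finite)
    (hinf : {r | m r ≠ 0}.Infinite) :
    ∃ lam : ℕ → ℝ, Monotone lam ∧ Tendsto lam atTop atTop ∧ Set.range lam = {r | m r ≠ 0} ∧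
      ∀ r, Nat.card {n : ℕ // lam n = r} = m r := by
  classical
  let F : ℝ → Finset ℝ := fun B => (hfin B).toFinset
  have hF : ∀ {B r}, r ∈ F B ↔ m r ≠ 0 ∧ r ≤ B := fun {B r} => (hfin B).mem_toFinset
  let N : ℝ → ℕ := fun B => ∑ r ∈ F B, m r
  have hNmono : Monotone N := fun B C h =>
    Finset.sum_le_sum_of_subset fun r hr => hF.mpr ⟨(hF.mp hr).1, (hF.mp hr).2.trans h⟩
  have hex : ∀ n, ∃ r, IsLeast {r | m r ≠ 0 ∧ n < N r} r := by
    intro n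
    obtain ⟨t, ht, htc⟩ := hinf.exists_subset_card_eq (n + 1)
    have htne : t.Nonempty := Finset.card_pos.mp (by omega)
    have hmem : n < N (t.max' htne) := by
      have h1 : t ⊆ F (t.max' htne) := fun r hr => hF.mpr ⟨ht hr, t.le_max' r hr⟩
      have h2 : ∑ r ∈ t, 1 ≤ ∑ r ∈ t, m r :=
        Finset.sum_le_sum fun r hr => Nat.one_le_iff_ne_zero.mpr (ht hr)
      have h3 : ∑ r ∈ t, m r ≤ N (t.max' htne) := Finset.sum_le_sum_of_subset h1
      rw [← Finset.card_eq_sum_ones, htc] at h2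
      omega
    have hne : ((F (t.max' htne)).filter fun r => n < N r).Nonempty :=
      ⟨_, Finset.mem_filter.mpr ⟨hF.mpr ⟨ht (t.max'_mem htne), le_rfl⟩, hmem⟩⟩
    obtain ⟨r, hr, hmin⟩ := Finset.exists_min_image _ id hne
    obtain ⟨hrF, hrn⟩ := Finset.mem_filter.mp hr
    refine ⟨r, ⟨(hF.mp hrF).1, hrn⟩, fun s hs => ?_⟩
    rcases le_total s (t.max' htne) with h | h
    · exact hmin s (Finset.mem_filter.mpr ⟨hF.mpr ⟨hs.1, h⟩, hs.2⟩)
    · exact (hF.mp hrF).2.trans h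
  choose lam hlam using hex
  have hcount : ∀ r, m r ≠ 0 → ∀ n, n ∈ Finset.Ico (∑ s ∈ (F r).erase r, m s)
      ((∑ s ∈ (F r).erase r, m s) + m r) ↔ lam n = r := by
    intro r hr n
    have hN : (∑ s ∈ (F r).erase r, m s) + m r = N r :=
      Finset.sum_erase_add _ _ (hF.mpr ⟨hr, le_rfl⟩)
    rw [hN, Finset.mem_Ico]
    constructor
    · rintro ⟨h1, h2⟩
      refine le_antisymm ((hlam n).2 ⟨hr, h2⟩) (not_lt.mp fun hlt => ?_)
      have hsub : F (lam n) ⊆ (F r).erase r := fun s hs => by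
        have := hF.mp hs
        exact Finset.mem_erase.mpr ⟨(this.2.trans_lt hlt).ne, hF.mpr ⟨this.1, this.2.trans hlt.le⟩⟩
      exact absurd ((hlam n).1.2.trans_le (Finset.sum_le_sum_of_subset hsub)) (not_lt.mpr h1)
    · rintro rfl
      refine ⟨not_lt.mp fun hlt => ?_, (hlam n).1.2⟩
      have hne : ((F (lam n)).erase (lam n)).Nonempty := by
        by_contra h
        rw [Finset.not_nonempty_iff_eq_empty] at h
        rw [h, Finset.sum_empty] at hlt
        omega
      -- The predecessor of `lam n` in the support already has more than `n` elements at or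
      -- below it.
      set s := ((F (lam n)).erase (lam n)).max' hne with hs
      obtain ⟨hs1, hs2⟩ := Finset.mem_erase.mp (Finset.max'_mem _ hne)
      have hsub : (F (lam n)).erase (lam n) ⊆ F s := fun t ht =>
        hF.mpr ⟨(hF.mp (Finset.mem_of_mem_erase ht)).1, Finset.le_max' _ t ht⟩
      have h1 : lam n ≤ s :=
        (hlam n).2 ⟨(hF.mp hs2).1, hlt.trans_le (Finset.sum_le_sum_of_subset hsub)⟩
      exact hs1 (le_antisymm (hF.mp hs2).2 h1)
  have hcard : ∀ r, Nat.card {n : ℕ // lam n = r} = m r := by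
    intro r
    by_cases hr : m r = 0
    · have : IsEmpty {n : ℕ // lam n = r} := ⟨fun n => (hlam n.1).1.1 (by rw [n.2]; exact hr)⟩
      rw [Nat.card_of_isEmpty, hr]
    · rw [Nat.subtype_card _ (hcount r hr), Nat.card_Ico, Nat.add_sub_cancel_left]
  refine ⟨lam, fun n k h => (hlam n).2 ⟨(hlam k).1.1, h.trans_lt (hlam k).1.2⟩, ?_, ?_, hcard⟩
  · refine tendsto_atTop.mpr fun B => eventually_atTop.mpr ⟨N B, fun n hn => ?_⟩
    by_contra! h
    exact absurd ((hlam n).1.2.trans_le (hNmono h.le)) (not_lt.mpr hn)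
  · refine Set.Subset.antisymm (Set.range_subset_iff.mpr fun n => (hlam n).1.1) fun r hr => ?_
    exact ⟨_, (hcount r hr _).mp (Finset.left_mem_Ico.mpr
      (Nat.lt_add_of_pos_right (Nat.pos_of_ne_zero hr)))⟩

section CompactResolvent

variable {E : Type*} [NormedAddCommGroup E] [InnerProductSpace ℂ E]
  {T : E →ₗ.[ℂ] E} {a : ℝ} {R : E →L[ℂ] E}

theorem IsResolventAt.exists_real_of_eigenspace_ne_bot (hR : IsResolventAt T (a : ℂ) R)
    (hpos : R.IsPositive) {z : ℂ} (hz : eigenspace T z ≠ ⊥) : ∃ r : ℝ, a < r ∧ z = r := by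
  have hza : z ≠ a := fun h => hz (h ▸ hR.eigenspace_self)
  have hne : z - a ≠ 0 := sub_ne_zero.mpr hza
  rw [hR.eigenspace_eq hza] at hz
  obtain ⟨x, hx, hx0⟩ := (Submodule.ne_bot_iff _).mp hz
  have hx : R x = (z - a)⁻¹ • x := Module.End.mem_eigenspace_iff.mp hx
  have hreal := hpos.isSymmetric.conj_eigenvalue_eq_self hz
  obtain ⟨t, ht⟩ := Complex.conj_eq_iff_real.mp hreal
  have h0 := hpos.re_inner_nonneg_left x
  rw [hx, ht, inner_smul_left, inner_self_eq_norm_sq_to_K, Complex.conj_ofReal] at h0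
  simp only [Complex.coe_algebraMap, RCLike.re_to_complex, ← Complex.ofReal_pow,
    ← Complex.ofReal_mul, Complex.ofReal_re] at h0
  have hxn : 0 < ‖x‖ ^ 2 := by positivity
  have ht0 : t ≠ 0 := by
    rintro rfl
    exact inv_ne_zero hne (by simpa using ht)
  have htpos : 0 < t := lt_of_le_of_ne (nonneg_of_mul_nonneg_left h0 hxn) ht0.symm
  refine ⟨a + t⁻¹, by simpa using htpos, ?_⟩
  rw [inv_eq_iff_eq_inv] at ht
  push_cast
  rw [← ht]
  ring

theorem IsResolventAt.finite_eigenvalues_le (hR : IsResolventAt T (a : ℂ) R)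
    (hcpt : IsCompactOperator R) (hpos : R.IsPositive) (B : ℝ) :
    {z : ℂ | eigenspace T z ≠ ⊥ ∧ z.re ≤ B}.Finite := by
  have hinj : Function.Injective fun z : ℂ => (z - a)⁻¹ := fun z w h => by
    simpa using inv_injective h
  have hδ : 0 < (max (B - a) 1)⁻¹ := by positivity
  refine ((finite_eigenvalues_of_isCompactOperator hcpt hpos.isSymmetric hδ).preimage
    hinj.injOn).subset ?_
  rintro z ⟨hz, hzB⟩
  obtain ⟨r, hr, rfl⟩ := hR.exists_real_of_eigenspace_ne_bot hpos hz
  have hza : (r : ℂ) ≠ a := by exact_mod_cast hr.ne'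
  rw [hR.eigenspace_eq hza] at hz
  refine ⟨hz, ?_⟩
  change _ ≤ ‖((r : ℂ) - a)⁻¹‖
  rw [← Complex.ofReal_sub, norm_inv, Complex.norm_real, Real.norm_of_nonneg (by linarith)]
  rw [Complex.ofReal_re] at hzB
  exact inv_anti₀ (by linarith) (le_max_of_le_left (by linarith))

theorem IsResolventAt.finiteDimensional_eigenspace [CompleteSpace E]
    (hR : IsResolventAt T (a : ℂ) R) (hcpt : IsCompactOperator R) (z : ℂ) :
    FiniteDimensional ℂ (eigenspace T z) := by
  rcases eq_or_ne z a with rfl | hz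
  · rw [hR.eigenspace_self]
    infer_instance
  · rw [hR.eigenspace_eq hz]
    exact ContinuousLinearMap.finite_dimensional_eigenspace hcpt _
      (inv_ne_zero (sub_ne_zero.mpr hz))

/-- The eigenspaces span a dense subspace, so finitely many of them, being finite-dimensional, do
not suffice in infinite dimension. -/
theorem IsResolventAt.infinite_eigenvalues [CompleteSpace E] (hE : ¬FiniteDimensional ℂ E)
    (hR : IsResolventAt T (a : ℂ) R) (hcpt : IsCompactOperator R) (hpos : R.IsPositive) :
    {z : ℂ | eigenspace T z ≠ ⊥}.Infinite := by
  intro hfin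
  refine hE ?_
  have hfd := fun z => hR.finiteDimensional_eigenspace hcpt z
  let W : Submodule ℂ E := hfin.toFinset.sup (eigenspace T)
  have hW : FiniteDimensional ℂ W := Submodule.finiteDimensional_finset_sup _ _
  have hle : (⨆ μ, Module.End.eigenspace (R : Module.End ℂ E) μ) ≤ W := by
    refine iSup_le fun μ => ?_
    rcases eq_or_ne μ 0 with rfl | hμ
    · intro x hx
      have hx0 : R x = 0 := by simpa using Module.End.mem_eigenspace_iff.mp hx
      rw [hR.injective hx0]
      exact W.zero_mem
    · have hz : (a : ℂ) + μ⁻¹ ≠ a := by simpa using hμ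
      have h := hR.eigenspace_eq hz
      rw [add_sub_cancel_left, inv_inv] at h
      rw [← h]
      by_cases hb : eigenspace T (a + μ⁻¹) = ⊥
      · rw [hb]
        exact bot_le
      · exact Finset.le_sup (f := eigenspace T) (hfin.mem_toFinset.mpr hb)
  have horth : Wᗮ = ⊥ := le_bot_iff.mp ((Submodule.orthogonal_le hle).trans
    (ContinuousLinearMap.orthogonalComplement_iSup_eigenspaces_eq_bot hcpt hpos.isSymmetric).le)
  have htop : W = ⊤ := (Submodule.orthogonal_eq_bot_iff).mp horth
  rw [htop] at hW
  exact Module.Finite.equiv (Submodule.topEquiv (R := ℂ) (M := E))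

/-- The spectral theorem for an operator with compact positive resolvent at a real point. -/
theorem IsResolventAt.discrete_spectrum [CompleteSpace E] (hE : ¬FiniteDimensional ℂ E)
    (hR : IsResolventAt T (a : ℂ) R) (hcpt : IsCompactOperator R) (hpos : R.IsPositive) :
    HasPurelyDiscreteSpectrum T ∧
    ∃ lam : ℕ → ℝ, Monotone lam ∧ Tendsto lam atTop atTop ∧
      spec T = Set.range (fun n => (lam n : ℂ)) ∧
      ∀ μ : ℝ, Module.finrank ℂ (eigenspace T (μ : ℂ)) = Nat.card {n : ℕ // lam n = μ} := by
  have hfd := fun z => hR.finiteDimensional_eigenspace hcpt z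
  have hspec : spec T = {z : ℂ | eigenspace T z ≠ ⊥} := Set.ext fun z => hR.mem_spec_iff hcpt
  refine ⟨fun z hz => ⟨?_, (hR.mem_spec_iff hcpt).mp hz, hfd z⟩, ?_⟩
  · have hfin := (hR.finite_eigenvalues_le hcpt hpos (z.re + 1)).subset
      (Set.sdiff_subset (t := {z}))
    obtain ⟨ε, hε, hball⟩ := Metric.mem_nhds_iff.mp
      (hfin.isClosed.isOpen_compl.mem_nhds fun h => h.2 rfl : _ ∈ 𝓝 z)
    refine ⟨min ε 1, by positivity, fun w hw hwz => ?_⟩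
    by_contra! hlt
    refine hball (hlt.trans_le (min_le_left _ _)) ⟨⟨(hR.mem_spec_iff hcpt).mp hw, ?_⟩, hwz⟩
    have h1 := (Complex.abs_re_le_norm (w - z)).trans_lt
      ((dist_eq_norm w z ▸ hlt).trans_le (min_le_right _ _))
    rw [Complex.sub_re] at h1
    linarith [(abs_lt.mp h1).2]
  · have hm : ∀ r : ℝ, Module.finrank ℂ (eigenspace T (r : ℂ)) ≠ 0 ↔ eigenspace T (r : ℂ) ≠ ⊥ :=
      fun r => not_congr Submodule.finrank_eq_zero
    have himage : {z : ℂ | eigenspace T z ≠ ⊥} =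
        (fun r : ℝ => (r : ℂ)) '' {r : ℝ | Module.finrank ℂ (eigenspace T (r : ℂ)) ≠ 0} := by
      ext z
      constructor
      · intro hz
        obtain ⟨r, -, rfl⟩ := hR.exists_real_of_eigenspace_ne_bot hpos hz
        exact ⟨r, (hm r).mpr hz, rfl⟩
      · rintro ⟨r, hr, rfl⟩
        exact (hm r).mp hr
    obtain ⟨lam, hmono, htend, hrange, hcard⟩ := exists_monotone_card_eq
      (fun r : ℝ => Module.finrank ℂ (eigenspace T (r : ℂ)))
      (fun B => ((hR.finite_eigenvalues_le hcpt hpos B).preimage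
        Complex.ofReal_injective.injOn).subset fun r hr => ⟨(hm r).mp hr.1, hr.2⟩)
      (Set.Infinite.of_image _ (himage ▸ hR.infinite_eigenvalues hE hcpt hpos))
    refine ⟨lam, hmono, htend, ?_, fun μ => (hcard μ).symm⟩
    rw [hspec, himage, ← hrange, ← Set.range_comp]
    rfl

end CompactResolvent

/-! ### Truncation in position and momentum -/

open scoped FourierTransform SchwartzMap

/-- On `L¹ ∩ L²` the unitary Fourier transform is given by the Fourier integral. Both sides have the
same pairing with every test function. -/
theorem fourierL2_ae_eq_fourier (f : HilbertL2) (hf : Integrable f) :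
    fourierL2 f =ᵐ[volume] 𝓕 (f : ℝ → ℂ) := by
  have hcont : Continuous (𝓕 (f : ℝ → ℂ)) :=
    VectorFourier.fourierIntegral_continuous Real.continuous_fourierChar
      (L := innerₗ ℝ) continuous_inner hf
  refine ae_eq_of_integral_contDiff_smul_eq
    ((Lp.memLp (fourierL2 f)).locallyIntegrable one_le_two) hcont.locallyIntegrable
    fun g hg hgs => ?_
  have hg₁ : HasCompactSupport (Complex.ofRealCLM ∘ g) := hgs.comp_left rfl
  have hg₂ : ContDiff ℝ ((⊤ : ℕ∞) : WithTop ℕ∞) (Complex.ofRealCLM ∘ g) := by fun_prop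
  let φ : 𝓢(ℝ, ℂ) := hg₁.toSchwartzMap hg₂
  have hφ : ∀ x, φ x = (g x : ℂ) := fun x => rfl
  have h1 := congrArg (fun D : 𝓢'(ℝ, ℂ) => D φ) (Lp.fourier_toTemperedDistribution_eq f)
  simp only [TemperedDistribution.fourier_apply, Lp.toTemperedDistribution_apply] at h1
  have h2 : ∫ x, (𝓕 φ) x • f x = ∫ x, φ x • 𝓕 (f : ℝ → ℂ) x := by
    rw [SchwartzMap.fourier_coe]
    simpa using! VectorFourier.integral_fourierIntegral_smul_eq_flip (L := innerₗ ℝ)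
      Real.continuous_fourierChar continuous_inner φ.integrable hf
  rw [h2] at h1
  exact h1.symm

/-- Multiplication by the indicator function of `s`, as a bounded operator on `L²(ℝ)`. -/
noncomputable def cutoff (s : Set ℝ) (hs : MeasurableSet s) : HilbertL2 →L[ℂ] HilbertL2 :=
  LinearMap.mkContinuous
    { toFun := fun f => ((Lp.memLp f).indicator hs).toLp
      map_add' := fun f g => by
        rw [← MemLp.toLp_add]
        refine MemLp.toLp_congr _ _ ?_
        filter_upwards [Lp.coeFn_add f g] with x hx
        change s.indicator (f + g : HilbertL2) x = s.indicator f x + s.indicator g x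
        by_cases h : x ∈ s
        · simp only [Set.indicator_of_mem h, hx, Pi.add_apply]
        · simp only [Set.indicator_of_notMem h, add_zero]
      map_smul' := fun a f => by
        rw [RingHom.id_apply, ← MemLp.toLp_const_smul]
        refine MemLp.toLp_congr _ _ ?_
        filter_upwards [Lp.coeFn_smul a f] with x hx
        change s.indicator (a • f : HilbertL2) x = a • s.indicator f x
        by_cases h : x ∈ s
        · simp only [Set.indicator_of_mem h, hx, Pi.smul_apply]
        · simp only [Set.indicator_of_notMem h, smul_zero] } 1 fun f => by
    refine Lp.norm_le_mul_norm_of_ae_le_mul ?_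
    filter_upwards [((Lp.memLp f).indicator hs).coeFn_toLp] with x hx
    change ‖((Lp.memLp f).indicator hs).toLp _ x‖ ≤ _
    rw [hx, one_mul]
    exact norm_indicator_le_norm_self _ _

theorem coeFn_cutoff (s : Set ℝ) (hs : MeasurableSet s) (f : HilbertL2) :
    cutoff s hs f =ᵐ[volume] s.indicator f :=
  ((Lp.memLp f).indicator hs).coeFn_toLp

theorem norm_cutoff_apply_le (s : Set ℝ) (hs : MeasurableSet s) (f : HilbertL2) :
    ‖cutoff s hs f‖ ≤ ‖f‖ := by
  refine Lp.norm_le_norm_of_ae_le ?_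
  filter_upwards [coeFn_cutoff s hs f] with x hx
  rw [hx]
  exact norm_indicator_le_norm_self _ _

/-- The norm of an `L²` function controls its integral over a set of finite measure. -/
theorem setIntegral_norm_le (s : Set ℝ) (hs : MeasurableSet s) (hsv : volume s ≠ ⊤)
    (f : HilbertL2) :
    ∫ x in s, ‖f x‖ ≤ ‖indicatorConstLp 2 hs hsv (1 : ℝ)‖ * ‖f‖ := by
  let h : Lp ℝ 2 (volume : Measure ℝ) := (Lp.memLp f).norm.toLp
  have hh : h =ᵐ[volume] fun x => ‖f x‖ := (Lp.memLp f).norm.coeFn_toLp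
  have hn : ‖h‖ ≤ ‖f‖ := Lp.norm_le_norm_of_ae_le (hh.mono fun x hx => by rw [hx, norm_norm])
  calc ∫ x in s, ‖f x‖ = ∫ x in s, h x :=
        integral_congr_ae ((ae_restrict_of_ae hh).mono fun x hx => hx.symm)
    _ = inner ℝ (indicatorConstLp 2 hs hsv (1 : ℝ)) h :=
        (L2.inner_indicatorConstLp_one hs hsv h).symm
    _ ≤ ‖indicatorConstLp 2 hs hsv (1 : ℝ)‖ * ‖h‖ := real_inner_le_norm _ _
    _ ≤ _ := mul_le_mul_of_nonneg_left hn (norm_nonneg _)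

theorem memLp_indicator_Icc {g : ℝ → ℂ} (hg : Continuous g) (r : ℝ) :
    MemLp ((Set.Icc (-r) r).indicator g) 2 volume := by
  rw [memLp_indicator_iff_restrict measurableSet_Icc]
  obtain ⟨C, hC⟩ := isCompact_Icc.exists_bound_of_continuousOn (s := Set.Icc (-r) r) hg.continuousOn
  exact MemLp.of_bound hg.aestronglyMeasurable C
    ((ae_restrict_iff' measurableSet_Icc).mpr (ae_of_all _ hC))

/-- Localization to a bounded region of phase space is compact: the kernel `exp (-2πikx)` is the
uniform limit of its Taylor polynomials there, and these are kernels of finite rank. -/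
theorem isCompactOperator_cutoff_fourier_cutoff (K N : ℝ) :
    IsCompactOperator (cutoff (Set.Icc (-K) K) measurableSet_Icc ∘L
      (fourierL2 : HilbertL2 →L[ℂ] HilbertL2) ∘L cutoff (Set.Icc (-N) N) measurableSet_Icc) := by
  let u : ℕ → HilbertL2 := fun n =>
    (memLp_indicator_Icc (g := fun k : ℝ => (-2 * Real.pi * Complex.I * k) ^ n / n.factorial)
      (by fun_prop) K).toLp
  let v : ℕ → HilbertL2 := fun n =>
    (memLp_indicator_Icc (g := fun x : ℝ => ((x ^ n : ℝ) : ℂ)) (by fun_prop) N).toLp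
  let A : ℕ → HilbertL2 →L[ℂ] HilbertL2 := fun p =>
    ∑ n ∈ Finset.range p, InnerProductSpace.rankOne ℂ (u n) (v n)
  have hA : ∀ p, IsCompactOperator (A p) := by
    intro p
    change A p ∈ compactOperator (RingHom.id ℂ) HilbertL2 HilbertL2
    refine Submodule.sum_mem _ fun n _ => ?_
    change IsCompactOperator (InnerProductSpace.rankOne ℂ (u n) (v n))
    rw [InnerProductSpace.rankOne_def']
    exact IsCompactOperator.comp_clm (isCompactOperator_of_locallyCompactSpace_rng
      (ContinuousLinearMap.toSpanSingleton ℂ (u n))) _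
  have hKv : volume (Set.Icc (-K) K) ≠ ⊤ := measure_Icc_lt_top.ne
  have hNv : volume (Set.Icc (-N) N) ≠ ⊤ := measure_Icc_lt_top.ne
  set C := ‖indicatorConstLp 2 measurableSet_Icc hNv (1 : ℝ)‖
  set D := ‖indicatorConstLp 2 measurableSet_Icc hKv (1 : ℂ)‖
  set M : ℝ := 2 * Real.pi * |K| * |N| with hM
  have hM0 : 0 ≤ M := by positivity
  set η : ℕ → ℝ := fun p => M ^ p / p.factorial * 2
  have hη0 : ∀ p, 0 ≤ η p := fun p => by positivity
  have hη : Tendsto η atTop (𝓝 0) := by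
    simpa using (FloorSemiring.tendsto_pow_div_factorial_atTop M).mul_const 2
  -- Beyond `p ≥ 2M` the Taylor remainder is at most twice the first omitted term.
  have htaylor : ∀ p : ℕ, 2 * M ≤ p → ∀ k ∈ Set.Icc (-K) K, ∀ x ∈ Set.Icc (-N) N,
      ‖Complex.exp (-2 * Real.pi * Complex.I * k * x) -
        ∑ n ∈ Finset.range p, (-2 * Real.pi * Complex.I * k * x) ^ n / n.factorial‖ ≤ η p := by
    intro p hp k hk x hx
    have hz : ‖(-2 * Real.pi * Complex.I * k * x : ℂ)‖ ≤ M := by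
      simp only [norm_mul, norm_neg, Complex.norm_ofNat, Complex.norm_real, Complex.norm_I,
        Real.norm_eq_abs, mul_one, abs_of_pos Real.pi_pos, hM]
      gcongr 2 * Real.pi * ?_ * ?_
      · exact (abs_le.mpr hk).trans (le_abs_self _)
      · exact (abs_le.mpr hx).trans (le_abs_self _)
    refine (Complex.exp_bound' ?_).trans ?_
    · rw [div_le_iff₀ (by positivity)]
      push_cast
      linarith
    · exact mul_le_mul_of_nonneg_right (by gcongr) zero_le_two
  have hbound : ∀ p : ℕ, 2 * M ≤ p →
      ‖A p - cutoff (Set.Icc (-K) K) measurableSet_Icc ∘L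
        (fourierL2 : HilbertL2 →L[ℂ] HilbertL2) ∘L cutoff (Set.Icc (-N) N) measurableSet_Icc‖ ≤
        η p * C * D := by
    intro p hp
    refine ContinuousLinearMap.opNorm_le_bound _ (by positivity) fun f => ?_
    set g := cutoff (Set.Icc (-N) N) measurableSet_Icc f with hg
    have hgae : g =ᵐ[volume] (Set.Icc (-N) N).indicator f := coeFn_cutoff _ _ f
    have hfint : IntegrableOn f (Set.Icc (-N) N) :=
      integrableOn_Lp_of_measure_ne_top f one_le_two hNv
    have hgint : Integrable g :=
      (integrable_congr hgae).mpr (hfint.integrable_indicator measurableSet_Icc)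
    have hinner : ∀ n, inner ℂ (v n) f = ∫ x in Set.Icc (-N) N, (x : ℂ) ^ n * f x := by
      intro n
      rw [L2.inner_def, ← integral_indicator measurableSet_Icc]
      refine integral_congr_ae ?_
      filter_upwards [(memLp_indicator_Icc (g := fun x : ℝ => ((x ^ n : ℝ) : ℂ))
        (by fun_prop) N).coeFn_toLp] with x hx
      change inner ℂ (MemLp.toLp _ _ x) (f x) = _
      rw [hx]
      by_cases h : x ∈ Set.Icc (-N) N
      · rw [Set.indicator_of_mem h, Set.indicator_of_mem h, RCLike.inner_apply,
          Complex.conj_ofReal, mul_comm, Complex.ofReal_pow]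
      · rw [Set.indicator_of_notMem h, Set.indicator_of_notMem h, inner_zero_left]
    have hfourier : ∀ k : ℝ, 𝓕 (g : ℝ → ℂ) k = ∫ x in Set.Icc (-N) N,
        Complex.exp (-2 * Real.pi * Complex.I * k * x) * f x := by
      intro k
      rw [Real.fourier_real_eq_integral_exp_smul, ← integral_indicator measurableSet_Icc]
      refine integral_congr_ae ?_
      filter_upwards [hgae] with x hx
      rw [hx]
      by_cases h : x ∈ Set.Icc (-N) N
      · rw [Set.indicator_of_mem h, Set.indicator_of_mem h, smul_eq_mul]
        congr 2
        push_cast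
        ring
      · rw [Set.indicator_of_notMem h, Set.indicator_of_notMem h, smul_zero]
    have hintmul : ∀ w : ℝ → ℂ, Continuous w →
        IntegrableOn (fun x => w x * f x) (Set.Icc (-N) N) := fun w hw =>
      hfint.continuousOn_mul hw.continuousOn isCompact_Icc
    have hpoint : ∀ k ∈ Set.Icc (-K) K,
        ‖(∑ n ∈ Finset.range p, inner ℂ (v n) f *
          ((-2 * Real.pi * Complex.I * k) ^ n / n.factorial)) - 𝓕 (g : ℝ → ℂ) k‖ ≤
          η p * C * ‖f‖ := by
      intro k hk
      have h1 : (∑ n ∈ Finset.range p, inner ℂ (v n) f *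
          ((-2 * Real.pi * Complex.I * k) ^ n / n.factorial)) = ∫ x in Set.Icc (-N) N,
          (∑ n ∈ Finset.range p, (-2 * Real.pi * Complex.I * k * x) ^ n / n.factorial) * f x := by
        simp only [Finset.sum_mul]
        rw [integral_finsetSum _ fun n _ => hintmul _ (by fun_prop)]
        refine Finset.sum_congr rfl fun n _ => ?_
        rw [hinner, ← integral_mul_const]
        refine integral_congr_ae (ae_of_all _ fun x => ?_)
        simp only [mul_pow]
        ring
      rw [h1, hfourier, ← integral_sub (hintmul _ (by fun_prop)) (hintmul _ (by fun_prop))]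
      calc _ ≤ ∫ x in Set.Icc (-N) N, η p * ‖f x‖ := by
            refine norm_integral_le_of_norm_le (hfint.norm.const_mul _) ?_
            refine (ae_restrict_iff' measurableSet_Icc).mpr (ae_of_all _ fun x hx => ?_)
            rw [← sub_mul, norm_mul, norm_sub_rev]
            exact mul_le_mul_of_nonneg_right (htaylor p hp k hk x hx) (norm_nonneg _)
        _ = η p * ∫ x in Set.Icc (-N) N, ‖f x‖ := integral_const_mul _ _
        _ ≤ η p * (C * ‖f‖) := by
            gcongr
            exact setIntegral_norm_le _ measurableSet_Icc hNv f
        _ = _ := by ring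
    have hpe : η p * C * D * ‖f‖ = η p * C * ‖f‖ * D := by ring
    rw [hpe]
    refine Lp.norm_le_mul_norm_of_ae_le_mul ?_
    have hAp : (A p f : ℝ → ℂ) =ᵐ[volume] ∑ n ∈ Finset.range p,
        ((inner ℂ (v n) f • u n : HilbertL2) : ℝ → ℂ) := by
      have : A p f = ∑ n ∈ Finset.range p, inner ℂ (v n) f • u n := by
        simp [A]
      rw [this]
      exact Lp.coeFn_finsetSum _ _
    have hterm : ∀ᵐ k : ℝ, ∀ n, (inner ℂ (v n) f • u n : HilbertL2) k = inner ℂ (v n) f *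
        (Set.Icc (-K) K).indicator
          (fun k : ℝ => (-2 * Real.pi * Complex.I * k : ℂ) ^ n / n.factorial) k := by
      refine ae_all_iff.mpr fun n => ?_
      filter_upwards [Lp.coeFn_smul (inner ℂ (v n) f) (u n), (memLp_indicator_Icc
        (g := fun k : ℝ => (-2 * Real.pi * Complex.I * k) ^ n / n.factorial)
        (by fun_prop) K).coeFn_toLp] with k h1 h2
      rw [h1, Pi.smul_apply, smul_eq_mul]
      exact congrArg _ h2
    filter_upwards [hAp, hterm, coeFn_cutoff (Set.Icc (-K) K) measurableSet_Icc (fourierL2 g),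
      fourierL2_ae_eq_fourier g hgint, Lp.coeFn_sub (A p f)
        (cutoff (Set.Icc (-K) K) measurableSet_Icc (fourierL2 g)),
      indicatorConstLp_coeFn (p := 2) (hs := measurableSet_Icc) (hμs := hKv) (c := (1 : ℂ))]
      with k h1 h2 h3 h4 h5 h6
    change ‖(A p f - cutoff (Set.Icc (-K) K) measurableSet_Icc (fourierL2 g) : HilbertL2) k‖ ≤ _
    rw [h5, h6, Pi.sub_apply, h1, h3, Finset.sum_apply]
    simp only [h2]
    by_cases h : k ∈ Set.Icc (-K) K
    · simp only [Set.indicator_of_mem h, h4, norm_one, mul_one]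
      exact hpoint k h
    · simp [Set.indicator_of_notMem h]
  refine isCompactOperator_of_tendsto (F := A) (l := atTop) ?_ (Eventually.of_forall hA)
  rw [tendsto_iff_norm_sub_tendsto_zero]
  refine squeeze_zero' (Eventually.of_forall fun _ => norm_nonneg _) ?_
    (g := fun p => η p * C * D) (by simpa using (hη.mul_const C).mul_const D)
  exact (eventually_ge_atTop ⌈2 * M⌉₊).mono fun p hp => hbound p (Nat.ceil_le.mp hp)

/-! ### The form of the functional difference operator -/

theorem quadForm_mulOp_eq_integral (m : ℝ → ℝ) (f : (mulOp m).domain) :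
    Integrable (fun x => m x * ‖(f : HilbertL2) x‖ ^ 2) ∧
      quadForm (mulOp m) f = ∫ x, m x * ‖(f : HilbertL2) x‖ ^ 2 := by
  have hint := L2.integrable_inner (𝕜 := ℂ) (mulOp m f) (f : HilbertL2)
  have hae : (fun x => (inner ℂ (mulOp m f x) ((f : HilbertL2) x) : ℂ).re) =ᵐ[volume]
      fun x => m x * ‖(f : HilbertL2) x‖ ^ 2 := by
    filter_upwards [mulOp_coeFn m f] with x hx
    rw [hx, ← smul_eq_mul, inner_smul_left, Complex.conj_ofReal, Complex.re_ofReal_mul,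
      inner_self_eq_norm_sq_to_K]
    norm_cast
  have hre := integral_re hint
  simp only [RCLike.re_to_complex] at hre
  exact ⟨hint.re.congr hae, by rw [quadForm, L2.inner_def, ← hre]; exact integral_congr_ae hae⟩

theorem norm_sq_eq_integral (f : HilbertL2) :
    Integrable (fun x => ‖f x‖ ^ 2) ∧ ‖f‖ ^ 2 = ∫ x, ‖f x‖ ^ 2 := by
  have hint := L2.integrable_inner (𝕜 := ℂ) f f
  have hre := integral_re hint
  simp only [RCLike.re_to_complex] at hre
  have hpt : ∀ x, (inner ℂ (f x) (f x) : ℂ).re = ‖f x‖ ^ 2 := fun x =>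
    inner_self_eq_norm_sq (𝕜 := ℂ) (f x)
  refine ⟨by simpa only [RCLike.re_to_complex, hpt] using hint.re, ?_⟩
  rw [← inner_self_eq_norm_sq (𝕜 := ℂ) f, L2.inner_def, RCLike.re_to_complex, ← hre]
  simp only [hpt]

/-- A weight that is at least `M` off `s` controls the part of `f` off `s` (Chebyshev). -/
theorem mul_norm_sub_cutoff_sq_le {m : ℝ → ℝ} (hm : ∀ x, 0 ≤ m x) {s : Set ℝ}
    (hs : MeasurableSet s) {M : ℝ} (hM : ∀ x ∉ s, M ≤ m x) (f : HilbertL2)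
    (hint : Integrable fun x => m x * ‖f x‖ ^ 2) :
    M * ‖f - cutoff s hs f‖ ^ 2 ≤ ∫ x, m x * ‖f x‖ ^ 2 := by
  obtain ⟨h1, h2⟩ := norm_sq_eq_integral (f - cutoff s hs f)
  rw [h2, ← integral_const_mul]
  refine integral_mono_ae (h1.const_mul M) hint ?_
  filter_upwards [Lp.coeFn_sub f (cutoff s hs f), coeFn_cutoff s hs f] with x h3 h4
  simp only [h3, Pi.sub_apply, h4]
  by_cases h : x ∈ s
  · rw [Set.indicator_of_mem h, sub_self, norm_zero]
    have := mul_nonneg (hm x) (sq_nonneg ‖f x‖)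
    simpa using this
  · rw [Set.indicator_of_notMem h, sub_zero]
    exact mul_le_mul_of_nonneg_right (hM x h) (sq_nonneg _)

theorem mulOp_isFormalAdjoint (m : ℝ → ℝ) : (mulOp m).IsFormalAdjoint (mulOp m) := by
  intro f g
  rw [L2.inner_def, L2.inner_def]
  refine integral_congr_ae ?_
  filter_upwards [mulOp_coeFn m f, mulOp_coeFn m g] with x hf hg
  rw [hf, hg, ← smul_eq_mul, ← smul_eq_mul, inner_smul_left, inner_smul_right, Complex.conj_ofReal]

theorem fourierMulOp_isFormalAdjoint (m : ℝ → ℝ) :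
    (fourierMulOp m).IsFormalAdjoint (fourierMulOp m) := by
  intro f g
  have h := mulOp_isFormalAdjoint m ⟨fourierL2 f, f.2⟩ ⟨fourierL2 g, g.2⟩
  change inner ℂ (fourierL2.symm (mulOp m ⟨fourierL2 f, f.2⟩)) (g : HilbertL2) =
    inner ℂ (f : HilbertL2) (fourierL2.symm (mulOp m ⟨fourierL2 g, g.2⟩))
  rw [← fourierL2.inner_map_map, fourierL2.apply_symm_apply, h,
    ← fourierL2.inner_map_map (f : HilbertL2), fourierL2.apply_symm_apply]

theorem isFormalAdjoint_add {E : Type*} [NormedAddCommGroup E] [InnerProductSpace ℂ E]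
    {S T : E →ₗ.[ℂ] E} (hS : S.IsFormalAdjoint S) (hT : T.IsFormalAdjoint T) :
    (S + T).IsFormalAdjoint (S + T) := by
  intro x y
  rw [LinearPMap.add_apply, LinearPMap.add_apply, inner_add_left, inner_add_right]
  exact congrArg₂ (· + ·) (hS ⟨x, x.2.1⟩ ⟨y, y.2.1⟩) (hT ⟨x, x.2.2⟩ ⟨y, y.2.2⟩)

theorem minimalOp_isFormalAdjoint (b : ℝ) (L : ℝ → ℝ) :
    (minimalOp b L).IsFormalAdjoint (minimalOp b L) :=
  isFormalAdjoint_add (isFormalAdjoint_add (fourierMulOp_isFormalAdjoint _)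
    (fourierMulOp_isFormalAdjoint _)) (mulOp_isFormalAdjoint L)

theorem quadForm_minimalOp (b : ℝ) (L : ℝ → ℝ) (x : (minimalOp b L).domain) :
    quadForm (minimalOp b L) x = quadForm (weylU b) ⟨x, x.2.1.1⟩ +
      quadForm (weylU (-b)) ⟨x, x.2.1.2⟩ + quadForm (mulOp L) ⟨x, x.2.2⟩ := by
  have e1 : quadForm (minimalOp b L) x = _ := quadForm_add (freeOp b) (mulOp L) x
  have e2 : quadForm (freeOp b) ⟨x, x.2.1⟩ = _ :=
    quadForm_add (weylU b) (weylU (-b)) ⟨x, x.2.1⟩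
  rw [e1, e2]

theorem le_quadForm_minimalOp (b : ℝ) {L : ℝ → ℝ} {c : ℝ} (hc : ∀ y, c ≤ L y)
    (x : (minimalOp b L).domain) :
    c * ‖(x : HilbertL2)‖ ^ 2 ≤ quadForm (minimalOp b L) x := by
  have h1 := le_quadForm_mulOp L c hc ⟨x, x.2.2⟩
  have h2 := quadForm_weylU_nonneg b ⟨x, x.2.1.1⟩
  have h3 := quadForm_weylU_nonneg (-b) ⟨x, x.2.1.2⟩
  rw [quadForm_minimalOp]
  linarith

/-- The weight of `U + U⁻¹` in momentum space grows at infinity. -/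
theorem exists_le_exp_add_exp {b : ℝ} (hb : 0 < b) (M : ℝ) :
    ∃ K : ℝ, ∀ k ∉ Set.Icc (-K) K,
      M ≤ Real.exp (-2 * Real.pi * b * k) + Real.exp (-2 * Real.pi * -b * k) := by
  have hc : 0 < 2 * Real.pi * b := by positivity
  refine ⟨M / (2 * Real.pi * b), fun k hk => ?_⟩
  have h1 : M < 2 * Real.pi * b * |k| := by
    rw [Set.mem_Icc, ← abs_le, not_le, div_lt_iff₀ hc] at hk
    linarith
  have h2 := Real.add_one_le_exp (-2 * Real.pi * b * k)
  have h3 := Real.add_one_le_exp (-2 * Real.pi * -b * k)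
  have h4 := Real.exp_pos (-2 * Real.pi * b * k)
  have h5 := Real.exp_pos (-2 * Real.pi * -b * k)
  rcases abs_cases k with ⟨h, -⟩ | ⟨h, -⟩ <;> rw [h] at h1 <;> linarith

theorem exists_le_of_tendsto_cocompact {L : ℝ → ℝ} (hlim : Tendsto L (cocompact ℝ) atTop) (M : ℝ) :
    ∃ N : ℝ, ∀ x ∉ Set.Icc (-N) N, M ≤ L x := by
  obtain ⟨t, ht, hsub⟩ := mem_cocompact.mp (hlim.eventually_ge_atTop M)
  obtain ⟨N, hN⟩ := ht.isBounded.subset_closedBall (0 : ℝ)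
  rw [Real.closedBall_eq_Icc, zero_sub, zero_add] at hN
  exact ⟨N, fun x hx => hsub fun h => hx (hN h)⟩

/-- On vectors of bounded form norm, truncation in position and momentum approximates the identity
uniformly: the potential is large off a bounded set of positions, `exp (-2πbk) + exp (2πbk)` off a
bounded set of momenta. -/
theorem minimalOp_exists_compact_approx {b : ℝ} (hb : 0 < b) {L : ℝ → ℝ} {c : ℝ}
    (hc : ∀ x, c ≤ L x) (hlim : Tendsto L (cocompact ℝ) atTop) {ε : ℝ} (hε : 0 < ε) :
    ∃ A : HilbertL2 →L[ℂ] HilbertL2, IsCompactOperator A ∧ ∀ x : (minimalOp b L).domain,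
      ‖(x : HilbertL2) - A x‖ ≤
        ε * √(quadForm (minimalOp b L) x + (1 - c) * ‖(x : HilbertL2)‖ ^ 2) := by
  obtain ⟨K, hK⟩ := exists_le_exp_add_exp hb ((2 / ε) ^ 2)
  obtain ⟨N, hN⟩ := exists_le_of_tendsto_cocompact hlim ((2 / ε) ^ 2 + c)
  refine ⟨(fourierL2.symm : HilbertL2 →L[ℂ] HilbertL2) ∘L
    (cutoff (Set.Icc (-K) K) measurableSet_Icc ∘L
      (fourierL2 : HilbertL2 →L[ℂ] HilbertL2) ∘L cutoff (Set.Icc (-N) N) measurableSet_Icc),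
    (isCompactOperator_cutoff_fourier_cutoff K N).clm_comp _, fun x => ?_⟩
  set Q := quadForm (minimalOp b L) x + (1 - c) * ‖(x : HilbertL2)‖ ^ 2
  have hQ : Q = (quadForm (weylU b) ⟨x, x.2.1.1⟩ + quadForm (weylU (-b)) ⟨x, x.2.1.2⟩) +
      quadForm (mulOp L) ⟨x, x.2.2⟩ + (1 - c) * ‖(x : HilbertL2)‖ ^ 2 := by
    rw [← quadForm_minimalOp]
  have hU := quadForm_weylU_nonneg b ⟨x, x.2.1.1⟩
  have hU' := quadForm_weylU_nonneg (-b) ⟨x, x.2.1.2⟩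
  have hLc := le_quadForm_mulOp L c hc ⟨x, x.2.2⟩
  have hsq := sq_nonneg ‖(x : HilbertL2)‖
  have hle : ∀ v : HilbertL2, (2 / ε) ^ 2 * ‖v‖ ^ 2 ≤ Q → ‖v‖ ≤ ε / 2 * √Q := by
    intro v hv
    rw [← mul_pow] at hv
    have := Real.le_sqrt_of_sq_le hv
    rw [div_mul_eq_mul_div, div_le_iff₀ hε] at this
    linarith
  have hpos : ‖(x : HilbertL2) - cutoff (Set.Icc (-N) N) measurableSet_Icc x‖ ≤ ε / 2 * √Q := by
    obtain ⟨i1, e1⟩ := quadForm_mulOp_eq_integral L ⟨x, x.2.2⟩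
    obtain ⟨i2, e2⟩ := norm_sq_eq_integral (x : HilbertL2)
    have i3 : Integrable fun y => (L y - c) * ‖(x : HilbertL2) y‖ ^ 2 := by
      simp only [sub_mul]
      exact i1.sub (i2.const_mul c)
    refine hle _ ((mul_norm_sub_cutoff_sq_le (fun y => sub_nonneg.mpr (hc y)) measurableSet_Icc
      (fun y hy => le_sub_iff_add_le.mpr (hN y hy)) (x : HilbertL2) i3).trans ?_)
    have e3 : ∫ y, (L y - c) * ‖(x : HilbertL2) y‖ ^ 2 =
        quadForm (mulOp L) ⟨x, x.2.2⟩ - c * ‖(x : HilbertL2)‖ ^ 2 := by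
      rw [e1, e2, ← integral_const_mul, ← integral_sub i1 (i2.const_mul c)]
      simp only [sub_mul]
    rw [e3, hQ]
    linarith
  have hmom : ‖fourierL2 x - cutoff (Set.Icc (-K) K) measurableSet_Icc (fourierL2 x)‖ ≤
      ε / 2 * √Q := by
    obtain ⟨i1, e1⟩ := quadForm_mulOp_eq_integral _ ⟨fourierL2 x, x.2.1.1⟩
    obtain ⟨i2, e2⟩ := quadForm_mulOp_eq_integral _ ⟨fourierL2 x, x.2.1.2⟩
    have i3 : Integrable fun k : ℝ => (Real.exp (-2 * Real.pi * b * k) +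
        Real.exp (-2 * Real.pi * -b * k)) * ‖fourierL2 (x : HilbertL2) k‖ ^ 2 := by
      simp only [add_mul]
      exact i1.add i2
    refine hle _ ((mul_norm_sub_cutoff_sq_le (fun k => by positivity) measurableSet_Icc hK
      (fourierL2 x) i3).trans ?_)
    have e3 : ∫ k : ℝ, (Real.exp (-2 * Real.pi * b * k) +
        Real.exp (-2 * Real.pi * -b * k)) * ‖fourierL2 (x : HilbertL2) k‖ ^ 2 =
        quadForm (weylU b) ⟨x, x.2.1.1⟩ + quadForm (weylU (-b)) ⟨x, x.2.1.2⟩ := by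
      have e4 : quadForm (weylU b) ⟨x, x.2.1.1⟩ = _ := (quadForm_fourierMulOp _ _).trans e1
      have e5 : quadForm (weylU (-b)) ⟨x, x.2.1.2⟩ = _ := (quadForm_fourierMulOp _ _).trans e2
      rw [e4, e5, ← integral_add i1 i2]
      simp only [add_mul]
    rw [e3, hQ]
    change c * ‖(x : HilbertL2)‖ ^ 2 ≤ _ at hLc
    linarith
  calc ‖(x : HilbertL2) - fourierL2.symm (cutoff (Set.Icc (-K) K) measurableSet_Icc
        (fourierL2 (cutoff (Set.Icc (-N) N) measurableSet_Icc x)))‖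
      = ‖fourierL2 x - cutoff (Set.Icc (-K) K) measurableSet_Icc
        (fourierL2 (cutoff (Set.Icc (-N) N) measurableSet_Icc x))‖ := by
        rw [← fourierL2.norm_map, map_sub, fourierL2.apply_symm_apply]
    _ = ‖(fourierL2 x - cutoff (Set.Icc (-K) K) measurableSet_Icc (fourierL2 x)) +
        cutoff (Set.Icc (-K) K) measurableSet_Icc
          (fourierL2 ((x : HilbertL2) - cutoff (Set.Icc (-N) N) measurableSet_Icc x))‖ := by
        rw [map_sub, map_sub, sub_add_sub_cancel]
    _ ≤ ε / 2 * √Q + ε / 2 * √Q := by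
        refine (norm_add_le _ _).trans (add_le_add hmom ((norm_cutoff_apply_le _ _ _).trans ?_))
        rw [fourierL2.norm_map]
        exact hpos
    _ = ε * √Q := by ring

theorem not_finiteDimensional_hilbertL2 : ¬FiniteDimensional ℂ HilbertL2 := by
  intro h
  have hfin : ∀ n : ℕ, volume (Set.Ioc (n : ℝ) (n + 1)) ≠ ⊤ := fun n => measure_Ioc_lt_top.ne
  let e : ℕ → HilbertL2 := fun n => indicatorConstLp 2 measurableSet_Ioc (hfin n) (1 : ℂ)
  have he : Orthonormal ℂ e := by
    rw [orthonormal_iff_ite]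
    intro i j
    change inner ℂ (indicatorConstLp 2 _ _ (1 : ℂ)) (indicatorConstLp 2 _ _ (1 : ℂ)) = _
    rw [L2.inner_indicatorConstLp_one_indicatorConstLp_one _ _ (hfin i) (hfin j)]
    split_ifs with hij
    · subst hij
      rw [Set.inter_self]
      simp
    · have hdisj : Disjoint (Set.Ioc (i : ℝ) (i + 1)) (Set.Ioc (j : ℝ) (j + 1)) := by
        have := Set.pairwise_disjoint_Ioc_intCast ℝ (i := (i : ℤ)) (j := (j : ℤ))
          (by exact_mod_cast hij)
        simpa [Function.onFun] using this
      rw [hdisj.inter_eq]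
      simp
  have := he.linearIndependent.finite
  exact not_finite ℕ

end FunctionalDifference

theorem proposition2p1 (b : ℝ) (hb : 0 < b) (L : ℝ → ℝ) (hcont : Continuous L)
    (hbdd : BddBelow (Set.range L)) (hlim : Filter.Tendsto L (Filter.cocompact ℝ) Filter.atTop)
    (hdense : Dense ((FunctionalDifference.minimalOp b L).domain : Set FunctionalDifference.HilbertL2)) :
    IsSelfAdjoint (FunctionalDifference.opT b L hbdd) ∧
    FunctionalDifference.HasPurelyDiscreteSpectrum (FunctionalDifference.opT b L hbdd) ∧
    ∃ lam : ℕ → ℝ, Monotone lam ∧ Filter.Tendsto lam Filter.atTop Filter.atTop ∧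
      FunctionalDifference.spec (FunctionalDifference.opT b L hbdd) =
        Set.range (fun n => (lam n : ℂ)) ∧
      ∀ μ : ℝ, Module.finrank ℂ
          (FunctionalDifference.eigenspace (FunctionalDifference.opT b L hbdd) (μ : ℂ)) =
        Nat.card {n : ℕ // lam n = μ} := by
  open FunctionalDifference in
  obtain ⟨c, hc⟩ := hbdd
  have hc' : ∀ y, c ≤ L y := fun y => hc ⟨y, rfl⟩
  obtain ⟨R, hR, hcpt, hpos⟩ := exists_compact_resolvent_friedrichsExtension
    (minimalOp_isBoundedBelow b ⟨c, hc⟩) hdense (minimalOp_isFormalAdjoint b L)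
    (le_quadForm_minimalOp b hc')
    fun ε hε => minimalOp_exists_compact_approx hb hc' hlim hε
  exact ⟨hR.isSelfAdjoint hpos.isSymmetric,
    hR.discrete_spectrum not_finiteDimensional_hilbertL2 hcpt hpos⟩
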